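/- Let $l>0$, $\sigma>0$, $\mathbb{T}^2=\mathbb{R}^2/(2l\mathbb{Z})^2$, $A=(1+\sigma)^{-1}$, $\alpha=\arccos A$, $\bar n_1=\sqrt{1-A^2}$, $\mathbf n^\pm=(\pm\bar n_1,0,A)$ and $W(\mathbf n)=\sigma n_2^2+\frac1A(n_3-A)^2$ for $\mathbf n=(n_1,n_2,n_3)\in\mathbb{S}^2$. Put $$c_0=\inf\Big\{\int_0^1\sqrt{W(\gamma(t))}\,|\gamma'(t)|\,dt:\ \gamma\in C^1([0,1],\mathbb{S}^2),\ \gamma(0)=\mathbf n^-,\ \gamma(1)=\mathbf n^+\Big\},$$ and let $\gamma_C(t)=(\sin(2\alpha t-\alpha),0,\cos(2\alpha t-\alpha))$, $t\in[0,1]$, be the great arc from $\mathbf n^-$ to $\mathbf n^+$. Let $\mathcal Y=W^{1,2}(\mathbb{T}^2,\mathbb{S}^2)\times W^{1,2}(\mathbb{T}^2)$, and let $\mathcal A$ be the set of pairs $(\mathbf n,g)\in BV(\mathbb{T}^2,\{\mathbf n^\pm\})\times W^{1,2}(\mathbb{T}^2)$ with $g_x\in BV(\mathbb{T}^2,\{\pm\bar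 n_1\})$ such that $g=g(x)$ and $\mathbf n=\mathbf n(x)$ depend on $x$ only, $g_x+n_1=0$ a.e., $n_2=0$ a.e., and $\int_{\mathbb{T}^2}n_1=0$. For $\varepsilon>0$ set $$G_\varepsilon(\mathbf n,g)=\int_{\mathbb{T}^2}\Big[\varepsilon|\nabla\mathbf n|^2+\frac1\varepsilon W(\mathbf n)+\frac1\varepsilon(g_x+n_1)^2+\frac1\varepsilon(g_y+n_2)^2\Big]dx\,dy$$ if $(\mathbf n,g)\in\mathcal Y$ and $G_\varepsilon(\mathbf n,g)=+\infty$ otherwise. Set $G_0(\mathbf n,g)=2c_0\,P_{\mathbb{T}^2}(\{\mathbf n=\mathbf n^-\})$ if $(\mathbf n,g)\in\mathcal A$ and $G_0(\mathbf n,g)=+\infty$ otherwise, where $P_{\mathbb{T}^2}(E)$ is the perimeter of $E$ in $\mathbb{T}^2$, i.e. the total variation on $\mathbb{T}^2$ of the characteristic function of $E$. Let $\varepsilon_j>0$ with $\varepsilon_j\to0$. Then for every $(\mathbf n,g)\in\mathcal A$ there is a sequence $(\mathbf n_j,g_j)\in\mathcal Y$ with $\mathbf n_j\to\mathbf n$ in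 $L^1(\mathbb{T}^2,\mathbb{S}^2)$ and $g_j\to g$ in $L^2(\mathbb{T}^2)$ as $j\to\infty$, and $$\limsup_{j\to\infty}G_{\varepsilon_j}(\mathbf n_j,g_j)=G_0(\mathbf n,g).$$ Moreover the sequence can be chosen so that, for every $j$, $\mathbf n_j(x,y)=\gamma_C(s_j(x))$ for a.e. $(x,y)$ with some function $s_j$ with values in $[0,1]$, and $\int_{\mathbb{T}^2}(\mathbf n_j)_1=0$. -/

import Mathlib

open MeasureTheory Filter Topology Set
open scoped ENNReal ContDiff

namespace Smectic

noncomputable section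

/-- The ambient space `ℝ³` of the director, with its Euclidean norm. -/
abbrev E3 : Type := EuclideanSpace ℝ (Fin 3)

/-! ### The flat torus `ℝ² / (2lℤ)²`

The torus is the square `[-l, l)²` with periodic boundary conditions.  A function on the torus
is a function on `ℝ × ℝ` considered almost everywhere on this square; periodicity enters through
the test functions, which are the smooth functions on the torus, that is, the smooth
`2l`-periodic functions on the plane. -/

/-- Lebesgue measure of the torus. -/
def torus (l : ℝ) : Measure (ℝ × ℝ) :=
  volume.restrict (Ico (-l) l ×ˢ Ico (-l) l)

/-- Smooth functions on the torus. -/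
def IsTest (l : ℝ) (φ : ℝ × ℝ → ℝ) : Prop :=
  ContDiff ℝ ∞ φ ∧ ∀ x y : ℝ, φ (x + 2 * l, y) = φ (x, y) ∧ φ (x, y + 2 * l) = φ (x, y)

/-- The `x`-direction. -/
def ex : ℝ × ℝ := (1, 0)

/-- The `y`-direction. -/
def ey : ℝ × ℝ := (0, 1)

/-- `v` is a weak (distributional) derivative of `u` on the torus in the direction `e`. -/
def HasWeakDeriv (l : ℝ) (e : ℝ × ℝ) (u v : ℝ × ℝ → ℝ) : Prop :=
  Integrable u (torus l) ∧ Integrable v (torus l) ∧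
    ∀ φ : ℝ × ℝ → ℝ, IsTest l φ →
      ∫ p, u p * fderiv ℝ φ p e ∂(torus l) = -∫ p, v p * φ p ∂(torus l)

open Classical in
/-- The weak derivative of `u` in the direction `e` (unique almost everywhere when it exists). -/
def weakDeriv (l : ℝ) (e : ℝ × ℝ) (u : ℝ × ℝ → ℝ) : ℝ × ℝ → ℝ :=
  if h : ∃ v, HasWeakDeriv l e u v then h.choose else 0

/-- `u ∈ W^{1,2}(𝕋²)`. -/
def MemW12 (l : ℝ) (u : ℝ × ℝ → ℝ) : Prop :=
  MemLp u 2 (torus l) ∧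
    (∃ v, HasWeakDeriv l ex u v ∧ MemLp v 2 (torus l)) ∧
    (∃ v, HasWeakDeriv l ey u v ∧ MemLp v 2 (torus l))

/-- The total variation of `u` on the torus: the supremum of `∫ u div (φ, ψ)` over smooth vector
fields on the torus of pointwise Euclidean length at most one. -/
def totalVariation (l : ℝ) (u : ℝ × ℝ → ℝ) : ℝ≥0∞ :=
  ⨆ (φ : ℝ × ℝ → ℝ) (ψ : ℝ × ℝ → ℝ) (_ : IsTest l φ) (_ : IsTest l ψ)
    (_ : ∀ p, φ p ^ 2 + ψ p ^ 2 ≤ 1),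
    ENNReal.ofReal (∫ p, u p * (fderiv ℝ φ p ex + fderiv ℝ ψ p ey) ∂(torus l))

/-- `u ∈ BV(𝕋²)`. -/
def MemBV (l : ℝ) (u : ℝ × ℝ → ℝ) : Prop :=
  Integrable u (torus l) ∧ totalVariation l u < ⊤

/-- The perimeter of `E` in the torus. -/
def perimeter (l : ℝ) (E : Set (ℝ × ℝ)) : ℝ≥0∞ :=
  totalVariation l (E.indicator fun _ => 1)

/-! ### The potential and its wells -/

/-- `A = (1 + σ)⁻¹`. -/
def wellA (σ : ℝ) : ℝ := (1 + σ)⁻¹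

/-- The potential `W(𝐧) = σ n₂² + (n₃ - A)² / A`. The components `n₁, n₂, n₃` of the director
are `n 0, n 1, n 2`. -/
def potW (σ : ℝ) (n : E3) : ℝ := σ * n 1 ^ 2 + 1 / wellA σ * (n 2 - wellA σ) ^ 2

/-- `n̄₁ = √(1 - A²)`. -/
def nbar (σ : ℝ) : ℝ := Real.sqrt (1 - wellA σ ^ 2)

/-- `𝐧⁺ = (n̄₁, 0, A)`. -/
def nPlus (σ : ℝ) : E3 := !₂[nbar σ, 0, wellA σ]

/-- `𝐧⁻ = (-n̄₁, 0, A)`. -/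
def nMinus (σ : ℝ) : E3 := !₂[-nbar σ, 0, wellA σ]

/-- `α = arccos A`. -/
def angle (σ : ℝ) : ℝ := Real.arccos (wellA σ)

/-- The great arc `γ_C` from `𝐧⁻` (at `t = 0`) to `𝐧⁺` (at `t = 1`). -/
def greatArc (σ t : ℝ) : E3 :=
  !₂[Real.sin (2 * angle σ * t - angle σ), 0, Real.cos (2 * angle σ * t - angle σ)]

/-- `c₀`: the infimum of `∫₀¹ √W(γ) |γ'|` over `C¹` curves on the sphere from `𝐧⁻` to `𝐧⁺`. -/
def c0 (σ : ℝ) : ℝ :=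
  sInf {c : ℝ | ∃ γ : ℝ → E3, ContDiffOn ℝ 1 γ (Icc 0 1) ∧ (∀ t ∈ Icc (0 : ℝ) 1, ‖γ t‖ = 1) ∧
    γ 0 = nMinus σ ∧ γ 1 = nPlus σ ∧
    c = ∫ t in (0 : ℝ)..1, Real.sqrt (potW σ (γ t)) * ‖derivWithin γ (Icc 0 1) t‖}

/-! ### The functionals -/

/-- `𝒴 = W^{1,2}(𝕋², 𝕊²) × W^{1,2}(𝕋²)`. -/
def setY (l : ℝ) : Set ((ℝ × ℝ → E3) × (ℝ × ℝ → ℝ)) :=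
  {u | (∀ i, MemW12 l fun p => u.1 p i) ∧ (∀ᵐ p ∂(torus l), ‖u.1 p‖ = 1) ∧ MemW12 l u.2}

/-- The set `𝒜` of limit configurations: `𝐧 ∈ BV(𝕋², {𝐧⁺, 𝐧⁻})`, `g ∈ W^{1,2}(𝕋²)`,
`g_x ∈ BV(𝕋², {±n̄₁})`, both depend on `x` only, `g_x + n₁ = 0`, `n₂ = 0` and `∫ n₁ = 0`. -/
def setA (l σ : ℝ) : Set ((ℝ × ℝ → E3) × (ℝ × ℝ → ℝ)) :=
  {u | (∀ i, MemBV l fun p => u.1 p i) ∧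
    (∀ᵐ p ∂(torus l), u.1 p = nPlus σ ∨ u.1 p = nMinus σ) ∧
    MemW12 l u.2 ∧
    MemBV l (weakDeriv l ex u.2) ∧
    (∀ᵐ p ∂(torus l), weakDeriv l ex u.2 p = nbar σ ∨ weakDeriv l ex u.2 p = -nbar σ) ∧
    (∃ h : ℝ → ℝ, ∀ᵐ p ∂(torus l), u.2 p = h p.1) ∧
    (∃ m : ℝ → E3, ∀ᵐ p ∂(torus l), u.1 p = m p.1) ∧
    (∀ᵐ p ∂(torus l), weakDeriv l ex u.2 p + u.1 p 0 = 0) ∧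
    (∀ᵐ p ∂(torus l), u.1 p 1 = 0) ∧
    ∫ p, u.1 p 0 ∂(torus l) = 0}

/-- The energy `F_ε`, as a `[0, ∞]`-valued integral of its non-negative density. -/
def energyF (l σ ε : ℝ) (n : ℝ × ℝ → E3) (g : ℝ × ℝ → ℝ) : ℝ≥0∞ :=
  ∫⁻ p, ENNReal.ofReal
    (ε * (∑ i : Fin 3, (weakDeriv l ex (fun q => n q i) p ^ 2
          + weakDeriv l ey (fun q => n q i) p ^ 2))
      + 1 / ε * potW σ (n p)
      + 1 / ε * (weakDeriv l ex g p + n p 0) ^ 2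
      + 1 / ε * (weakDeriv l ey g p + n p 1) ^ 2) ∂(torus l)

open Classical in
/-- `G_ε`: equal to `F_ε` on `𝒴` and `+∞` elsewhere. -/
def energyG (l σ ε : ℝ) (n : ℝ × ℝ → E3) (g : ℝ × ℝ → ℝ) : ℝ≥0∞ :=
  if (n, g) ∈ setY l then energyF l σ ε n g else ⊤

open Classical in
/-- `G₀`: equal to `2 c₀ P({𝐧 = 𝐧⁻})` on `𝒜` and `+∞` elsewhere. -/
def energyG0 (l σ : ℝ) (n : ℝ × ℝ → E3) (g : ℝ × ℝ → ℝ) : ℝ≥0∞ :=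
  if (n, g) ∈ setA l σ then ENNReal.ofReal (2 * c0 σ) * perimeter l {p | n p = nMinus σ} else ⊤

end

end Smectic

namespace Smectic

/-! ### Integration on the torus -/

/-! A limit director is `circlePt (v x * α)` with `v = ±1` periodic, of mean zero and of bounded
variation, so `v` has finitely many jumps, say `k`, in each period. Let `D` be the signed distance
to the jumps truncated at `±δ`, obtained as a box average of `v`. The recovery director is `circlePt
(θ (D x))`, where `θ = profile σ ε` is the odd explicit solution of `ε θ' = √W` along the great arc.
The displacement is a primitive of minus the first component of the director, so both coupling terms
of the energy vanish identically.

Two features of `D` make the construction exact. It has slope `±1` in the layers `|D| < δ`, and its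
plateaus at `δ` and `-δ` have the same measure because `v` has mean zero. As `θ` is odd, the first
component of the director therefore has mean zero without any correction, and its primitive is
periodic. By equipartition the energy equals `2l (4 k Ψ(θ(δ)) + 2 a w(δ))`, where `Ψ = arcCost σ` is
the primitive of `√W` along the circle, `w = profileEnergy σ ε` is the potential density and `a` is
the measure of a plateau in a period. As `ε → 0`, `θ(δ) → α` and `w(δ) → 0`, so the limit is `8 l k
Ψ(α)`.

This is `G₀`, for two reasons. The perimeter of the phase is `2 l k` (`IsTruncDist.perimeter_eq`):
test functions concentrated at the jumps give the lower bound, and approximation of `v` by steep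
truncations of `D` gives the upper one. And `c₀ = 2 Ψ(α)` (`c0_eq`): the great arc has this cost,
and a calibration depending only on `n₁` bounds the cost of every competitor from below
(`calib_mul_le`, `le_cost`). -/

theorem torus_eq_prod (l : ℝ) :
    torus l = (volume.restrict (Ico (-l) l)).prod (volume.restrict (Ico (-l) l)) := by
  rw [torus, Measure.prod_restrict, Measure.volume_eq_prod]

theorem torus_eq_restrict_Ioo (l : ℝ) :
    torus l = volume.restrict (Ioo (-l) l ×ˢ Ioo (-l) l) := by
  rw [torus_eq_prod, Measure.restrict_congr_set Ioo_ae_eq_Ico.symm,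
    Measure.prod_restrict, Measure.volume_eq_prod]

instance (l : ℝ) : IsFiniteMeasure (torus l) := by
  rw [torus_eq_prod]; infer_instance

theorem integral_torus_fst {l : ℝ} (hl : 0 < l) (f : ℝ → ℝ) :
    ∫ p, f p.1 ∂(torus l) = 2 * l * ∫ x in -l..l, f x := by
  rw [torus_eq_prod, integral_fun_fst, intervalIntegral.integral_of_le (by linarith),
    ← integral_Ico_eq_integral_Ioc]
  simp only [measureReal_restrict_apply_univ, Real.volume_real_Ico, smul_eq_mul]
  rw [max_eq_left (by linarith)]; ring

theorem ae_torus_fst {l : ℝ} {P : ℝ → Prop} (h : ∀ᵐ x ∂(volume.restrict (Ico (-l) l)), P x) :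
    ∀ᵐ p ∂(torus l), P p.1 := by
  rw [torus_eq_prod]
  exact Measure.quasiMeasurePreserving_fst.ae h

theorem exists_bound_torus {φ : ℝ × ℝ → ℝ} (hφ : Continuous φ) (l : ℝ) :
    ∃ C, ∀ᵐ p ∂(torus l), ‖φ p‖ ≤ C := by
  obtain ⟨C, hC⟩ := (isCompact_Icc.prod isCompact_Icc :
    IsCompact (Icc (-l) l ×ˢ Icc (-l) l)).exists_bound_of_continuousOn hφ.continuousOn
  refine ⟨C, ?_⟩
  rw [torus]
  filter_upwards [ae_restrict_mem (measurableSet_Ico.prod measurableSet_Ico)] with p hp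
  exact hC p ⟨Ico_subset_Icc_self hp.1, Ico_subset_Icc_self hp.2⟩

theorem integrable_torus_of_bound {l C : ℝ} {f : ℝ × ℝ → ℝ}
    (hf : AEStronglyMeasurable f (torus l)) (hC : ∀ᵐ p ∂(torus l), ‖f p‖ ≤ C) :
    Integrable f (torus l) :=
  (memLp_top_of_bound hf C hC).integrable le_top

theorem memLp_torus_of_bound {l C : ℝ} {f : ℝ × ℝ → ℝ}
    (hf : AEStronglyMeasurable f (torus l)) (hC : ∀ᵐ p ∂(torus l), ‖f p‖ ≤ C) :
    MemLp f 2 (torus l) :=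
  MemLp.of_bound hf C hC

theorem integrable_mul_continuous {l : ℝ} {f φ : ℝ × ℝ → ℝ}
    (hf : Integrable f (torus l)) (hφ : Continuous φ) :
    Integrable (fun p => f p * φ p) (torus l) := by
  obtain ⟨C, hC⟩ := exists_bound_torus hφ l
  exact hf.mul_bdd hφ.aestronglyMeasurable hC

/-! ### Test functions -/

theorem IsTest.continuous {l : ℝ} {φ : ℝ × ℝ → ℝ} (h : IsTest l φ) : Continuous φ :=
  h.1.continuous

theorem IsTest.continuous_fderiv {l : ℝ} {φ : ℝ × ℝ → ℝ} (h : IsTest l φ) (e : ℝ × ℝ) :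
    Continuous fun p => fderiv ℝ φ p e :=
  (h.1.continuous_fderiv (by simp)).clm_apply continuous_const

theorem isTest_zero (l : ℝ) : IsTest l (fun _ => 0) :=
  ⟨contDiff_const, fun _ _ => ⟨rfl, rfl⟩⟩

theorem hasDerivAt_fst_section {φ : ℝ × ℝ → ℝ} (h : ContDiff ℝ ∞ φ) (x y : ℝ) :
    HasDerivAt (fun x => φ (x, y)) (fderiv ℝ φ (x, y) ex) x :=
  ((h.differentiable (by simp)) (x, y)).hasFDerivAt.comp_hasDerivAt x
    ((hasDerivAt_id x).prodMk (hasDerivAt_const x y))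

theorem hasDerivAt_snd_section {φ : ℝ × ℝ → ℝ} (h : ContDiff ℝ ∞ φ) (x y : ℝ) :
    HasDerivAt (fun y => φ (x, y)) (fderiv ℝ φ (x, y) ey) y :=
  ((h.differentiable (by simp)) (x, y)).hasFDerivAt.comp_hasDerivAt y
    ((hasDerivAt_const y x).prodMk (hasDerivAt_id y))

theorem IsTest.left_eq_right {l : ℝ} {φ : ℝ × ℝ → ℝ} (h : IsTest l φ) (y : ℝ) :
    φ (l, y) = φ (-l, y) := by
  have := (h.2 (-l) y).1
  rwa [show -l + 2 * l = l by ring] at this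

theorem IsTest.top_eq_bot {l : ℝ} {φ : ℝ × ℝ → ℝ} (h : IsTest l φ) (x : ℝ) :
    φ (x, l) = φ (x, -l) := by
  have := (h.2 x (-l)).2
  rwa [show -l + 2 * l = l by ring] at this

theorem isTest_fst {l : ℝ} {f : ℝ → ℝ} (hf : ContDiff ℝ ∞ f) (hp : f.Periodic (2 * l)) :
    IsTest l (fun p => f p.1) :=
  ⟨hf.comp contDiff_fst, fun x _ => ⟨hp x, rfl⟩⟩

theorem fderiv_comp_fst_ex {f : ℝ → ℝ} (hf : ContDiff ℝ ∞ f) (p : ℝ × ℝ) :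
    fderiv ℝ (fun p : ℝ × ℝ => f p.1) p ex = deriv f p.1 :=
  (hasDerivAt_fst_section (hf.comp contDiff_fst) p.1 p.2).deriv.symm

/-! ### Periodization -/

/-- Reduction modulo `T` is locally a translation except at the ends of the period, and there `f`
vanishes on both sides. Only the first coordinate is reduced, so that the lemma can be applied to
each coordinate in turn. -/
theorem contDiff_comp_toIcoMod {T : ℝ} (hT : 0 < T) {a b c : ℝ} (ha : c < a) (hb : b < c + T)
    {f : ℝ × ℝ → ℝ} (hf : ContDiff ℝ ∞ f) (h0 : ∀ p : ℝ × ℝ, p.1 ∉ Icc a b → f p = 0) :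
    ContDiff ℝ ∞ (fun p : ℝ × ℝ => f (toIcoMod hT c p.1, p.2)) := by
  rw [contDiff_iff_contDiffAt]
  rintro ⟨x₀, y₀⟩
  set m := toIcoDiv hT c x₀ with hm
  have hmem : x₀ - m • T ∈ Ico c (c + T) := sub_toIcoDiv_zsmul_mem_Ico hT c x₀
  have hsm : ContDiff ℝ ∞ (fun p : ℝ × ℝ => f (p.1 - m • T, p.2)) :=
    hf.comp ((contDiff_fst.sub contDiff_const).prodMk contDiff_snd)
  refine hsm.contDiffAt.congr_of_eventuallyEq ?_
  -- Within this distance of `x₀` the reduction is subtraction of `m • T` up to one period, and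
  -- where it differs both arguments of `f` miss `Icc a b`.
  have hη : 0 < min (min (a - c) (c + T - b)) T := by
    simp only [lt_min_iff]; exact ⟨⟨by linarith, by linarith⟩, hT⟩
  set η := min (min (a - c) (c + T - b)) T
  have h1 : η ≤ a - c := (min_le_left _ _).trans (min_le_left _ _)
  have h2 : η ≤ c + T - b := (min_le_left _ _).trans (min_le_right _ _)
  have h3 : η ≤ T := min_le_right _ _
  have hnb : ∀ᶠ p : ℝ × ℝ in 𝓝 (x₀, y₀), |p.1 - x₀| < η := by
    have : Continuous fun p : ℝ × ℝ => |p.1 - x₀| := by fun_prop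
    exact this.continuousAt.eventually_lt continuousAt_const (by simpa using hη)
  filter_upwards [hnb] with p hp
  rw [abs_lt] at hp
  obtain ⟨hm1, hm2⟩ := hmem
  by_cases hlt : p.1 - m • T < c
  · have : toIcoMod hT c p.1 = p.1 - m • T + T :=
      (toIcoMod_eq_iff hT).2 ⟨⟨by linarith, by linarith⟩, m - 1, by
        simp only [zsmul_eq_mul]; push_cast; ring⟩
    rw [this, h0, h0]
    · rintro ⟨h, -⟩; dsimp only at h; linarith
    · rintro ⟨-, h⟩; dsimp only at h; linarith
  by_cases hge : c + T ≤ p.1 - m • T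
  · have : toIcoMod hT c p.1 = p.1 - m • T - T :=
      (toIcoMod_eq_iff hT).2 ⟨⟨by linarith, by linarith⟩, m + 1, by
        simp only [zsmul_eq_mul]; push_cast; ring⟩
    rw [this, h0, h0]
    · rintro ⟨-, h⟩; dsimp only at h; linarith
    · rintro ⟨h, -⟩; dsimp only at h; linarith
  · have : toIcoMod hT c p.1 = p.1 - m • T :=
      (toIcoMod_eq_iff hT).2 ⟨⟨by linarith, by linarith⟩, m, by ring⟩
    rw [this]

theorem exists_Icc_of_isCompact_subset_Ioo {K : Set ℝ} (hK : IsCompact K) {c d : ℝ}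
    (h : K ⊆ Ioo c d) : ∃ a b, c < a ∧ b < d ∧ K ⊆ Icc a b := by
  rcases K.eq_empty_or_nonempty with rfl | hne
  · exact ⟨c + 1, d - 1, by linarith, by linarith, empty_subset _⟩
  · obtain ⟨a, ha⟩ := hK.exists_isLeast hne
    obtain ⟨b, hb⟩ := hK.exists_isGreatest hne
    exact ⟨a, b, (h ha.1).1, (h hb.1).2, fun x hx => ⟨ha.2 hx, hb.2 hx⟩⟩

/-- Extend a function with support in a square of side `2l` to a test function on the torus. -/
theorem exists_isTest_eqOn {l : ℝ} (hl : 0 < l) {g : ℝ × ℝ → ℝ} (hg : ContDiff ℝ ∞ g)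
    (hc : HasCompactSupport g) (hs : tsupport g ⊆ Ioo (-l) l ×ˢ Ioo (-l) l) :
    ∃ φ, IsTest l φ ∧ EqOn φ g (Ico (-l) l ×ˢ Ico (-l) l) := by
  have hT : (0 : ℝ) < 2 * l := by linarith
  obtain ⟨a, b, ha, hb, hab⟩ := exists_Icc_of_isCompact_subset_Ioo
    (IsCompact.image hc continuous_fst) (c := -l) (d := l) (by
      rintro _ ⟨p, hp, rfl⟩; exact (hs hp).1)
  obtain ⟨a', b', ha', hb', hab'⟩ := exists_Icc_of_isCompact_subset_Ioo
    (IsCompact.image hc continuous_snd) (c := -l) (d := l) (by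
      rintro _ ⟨p, hp, rfl⟩; exact (hs hp).2)
  have hx0 : ∀ p : ℝ × ℝ, p.1 ∉ Icc a b → g p = 0 := fun p hp => by
    by_contra h
    exact hp (hab ⟨p, subset_tsupport g h, rfl⟩)
  have hy0 : ∀ p : ℝ × ℝ, p.2 ∉ Icc a' b' → g p = 0 := fun p hp => by
    by_contra h
    exact hp (hab' ⟨p, subset_tsupport g h, rfl⟩)
  have h1 := contDiff_comp_toIcoMod hT ha (by linarith : b < -l + 2 * l) hg hx0
  -- The second coordinate is periodized after exchanging the coordinates; the exchange is then
  -- undone.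
  have h2 := contDiff_comp_toIcoMod hT ha' (by linarith : b' < -l + 2 * l)
    (h1.comp (contDiff_snd.prodMk contDiff_fst : ContDiff ℝ ∞ fun p : ℝ × ℝ => (p.2, p.1)))
    (fun p hp => hy0 _ hp)
  have h3 := h2.comp (contDiff_snd.prodMk contDiff_fst : ContDiff ℝ ∞ fun p : ℝ × ℝ => (p.2, p.1))
  refine ⟨_, ⟨h3, fun x y => ⟨?_, ?_⟩⟩, ?_⟩
  · simp only [Function.comp_apply, toIcoMod_add_right]
  · simp only [Function.comp_apply, toIcoMod_add_right]
  · rintro ⟨x, y⟩ ⟨hx, hy⟩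
    have e1 : toIcoMod hT (-l) x = x :=
      (toIcoMod_eq_self hT).2 ⟨hx.1, by linarith [hx.2]⟩
    have e2 : toIcoMod hT (-l) y = y :=
      (toIcoMod_eq_self hT).2 ⟨hy.1, by linarith [hy.2]⟩
    simp only [Function.comp_apply, e1, e2]

/-- Extend a function of one variable with support in an interval of length `T` periodically. -/
theorem exists_periodic_eqOn {T c : ℝ} (hT : 0 < T) {f : ℝ → ℝ} (hf : ContDiff ℝ ∞ f)
    (hc : HasCompactSupport f) (hs : tsupport f ⊆ Ioo c (c + T)) :
    ∃ φ : ℝ → ℝ, ContDiff ℝ ∞ φ ∧ φ.Periodic T ∧ EqOn φ f (Ico c (c + T)) ∧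
      (∀ x, ∃ y, φ x = f y) := by
  obtain ⟨a, b, ha, hb, hab⟩ := exists_Icc_of_isCompact_subset_Ioo hc hs
  have h1 := contDiff_comp_toIcoMod hT ha hb (hf.comp contDiff_fst) (fun p hp => by
    by_contra h
    exact hp (hab (subset_tsupport f h)))
  refine ⟨fun x => f (toIcoMod hT c x), ?_, fun x => ?_, fun x hx => ?_, fun x => ⟨_, rfl⟩⟩
  · exact h1.comp (contDiff_id.prodMk contDiff_const : ContDiff ℝ ∞ fun x : ℝ => (x, (0 : ℝ)))
  · simp only [toIcoMod_add_right]
  · simp only [(toIcoMod_eq_self hT).2 hx]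

/-! ### Weak derivatives -/

/-- The fundamental lemma of the calculus of variations on the open square: its compactly supported
test functions extend periodically, and the boundary is null. This makes the chosen `weakDeriv`
computable. -/
theorem HasWeakDeriv.ae_eq {l : ℝ} (hl : 0 < l) {e : ℝ × ℝ} {u v w : ℝ × ℝ → ℝ}
    (hv : HasWeakDeriv l e u v) (hw : HasWeakDeriv l e u w) : v =ᵐ[torus l] w := by
  have key : ∀ φ, IsTest l φ → ∫ p, (v p - w p) * φ p ∂(torus l) = 0 := fun φ hφ => by
    have h1 := hv.2.2 φ hφ
    have h2 := hw.2.2 φ hφ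
    simp only [sub_mul]
    rw [integral_sub (integrable_mul_continuous hv.2.1 hφ.continuous)
      (integrable_mul_continuous hw.2.1 hφ.continuous)]
    linarith
  have hU : IsOpen (Ioo (-l) l ×ˢ Ioo (-l) l) := isOpen_Ioo.prod isOpen_Ioo
  have hint : IntegrableOn (fun p => v p - w p) (Ioo (-l) l ×ˢ Ioo (-l) l) volume := by
    have := hv.2.1.sub hw.2.1
    rwa [torus_eq_restrict_Ioo] at this
  have := hU.ae_eq_zero_of_integral_contDiff_smul_eq_zero hint.locallyIntegrableOn
    (fun g hg hc hs => by
      obtain ⟨φ, hφ, he⟩ := exists_isTest_eqOn hl hg hc hs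
      have h1 : ∫ p, (v p - w p) * φ p ∂(torus l) = ∫ p, (v p - w p) * g p ∂(torus l) :=
        setIntegral_congr_fun (measurableSet_Ico.prod measurableSet_Ico)
          (fun p hp => by simp only [he hp])
      rw [key φ hφ, torus_eq_restrict_Ioo,
        setIntegral_eq_integral_of_forall_compl_eq_zero (fun p hp => by
          rw [image_eq_zero_of_notMem_tsupport (fun h => hp (hs h)), mul_zero])] at h1
      rw [h1]
      simp only [smul_eq_mul, mul_comm])
  rw [torus_eq_restrict_Ioo]
  refine (ae_restrict_iff' hU.measurableSet).2 ?_
  filter_upwards [this] with p hp hpU using sub_eq_zero.1 (hp hpU)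

theorem HasWeakDeriv.weakDeriv_ae_eq {l : ℝ} (hl : 0 < l) {e : ℝ × ℝ} {u v : ℝ × ℝ → ℝ}
    (hv : HasWeakDeriv l e u v) : weakDeriv l e u =ᵐ[torus l] v := by
  have hex : ∃ v, HasWeakDeriv l e u v := ⟨v, hv⟩
  rw [weakDeriv, dif_pos hex]
  exact hex.choose_spec.ae_eq hl hv

theorem hasWeakDeriv_weakDeriv {l : ℝ} {e : ℝ × ℝ} {u : ℝ × ℝ → ℝ}
    (h : ∃ v, HasWeakDeriv l e u v) : HasWeakDeriv l e u (weakDeriv l e u) := by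
  rw [weakDeriv, dif_pos h]; exact h.choose_spec

theorem HasWeakDeriv.congr {l : ℝ} {e : ℝ × ℝ} {u v w : ℝ × ℝ → ℝ}
    (h : HasWeakDeriv l e u v) (hw : v =ᵐ[torus l] w) : HasWeakDeriv l e u w := by
  refine ⟨h.1, h.2.1.congr hw, fun φ hφ => ?_⟩
  rw [h.2.2 φ hφ]
  congr 1
  exact integral_congr_ae (hw.mono fun p hp => by simp only [hp])

/-- Fubini, then integration by parts for absolutely continuous functions on each horizontal line;
periodicity cancels the boundary terms. -/
theorem hasWeakDeriv_ex_of_lipschitz {l : ℝ} (hl : 0 < l) {K : NNReal} {u : ℝ → ℝ}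
    (hu : LipschitzWith K u) (hp : u.Periodic (2 * l)) :
    HasWeakDeriv l ex (fun p => u p.1) (fun p => deriv u p.1) := by
  have hi : Integrable (fun p : ℝ × ℝ => u p.1) (torus l) := by
    have hc : Continuous fun p : ℝ × ℝ => u p.1 := hu.continuous.comp continuous_fst
    obtain ⟨C, hC⟩ := exists_bound_torus hc l
    exact integrable_torus_of_bound hc.aestronglyMeasurable hC
  have hi' : Integrable (fun p : ℝ × ℝ => deriv u p.1) (torus l) :=
    integrable_torus_of_bound
      ((measurable_deriv u).comp measurable_fst).aestronglyMeasurable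
      (Eventually.of_forall fun p => norm_deriv_le_of_lipschitz hu)
  refine ⟨hi, hi', fun φ hφ => ?_⟩
  have i1 := integrable_mul_continuous hi (hφ.continuous_fderiv ex)
  have i2 := integrable_mul_continuous hi' hφ.continuous
  rw [torus_eq_prod] at i1 i2 ⊢
  rw [integral_prod_symm _ i1, integral_prod_symm _ i2, ← integral_neg]
  refine integral_congr_ae (Eventually.of_forall fun y => ?_)
  have hle : -l ≤ l := by linarith
  simp only [integral_Ico_eq_integral_Ioc]
  rw [← intervalIntegral.integral_of_le hle, ← intervalIntegral.integral_of_le hle]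
  have hφ' : AbsolutelyContinuousOnInterval (fun x => φ (x, y)) (-l) l := by
    apply ContDiffOn.absolutelyContinuousOnInterval
    apply ContDiff.contDiffOn
    exact (hφ.1.comp (contDiff_id.prodMk contDiff_const)).of_le (by simp)
  have h := hu.lipschitzOnWith.absolutelyContinuousOnInterval.integral_mul_deriv_eq_deriv_mul hφ'
  have hb : u l = u (-l) := by
    have := hp (-l); rwa [show -l + 2 * l = l by ring] at this
  simp only [(hasDerivAt_fst_section hφ.1 _ y).deriv] at h
  rw [h, hφ.left_eq_right, hb]
  ring

theorem integral_mul_fderiv_ey {l : ℝ} (hl : 0 < l) {u : ℝ → ℝ}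
    (hi : Integrable (fun p : ℝ × ℝ => u p.1) (torus l)) {φ : ℝ × ℝ → ℝ} (hφ : IsTest l φ) :
    ∫ p, u p.1 * fderiv ℝ φ p ey ∂(torus l) = 0 := by
  have i1 := integrable_mul_continuous hi (hφ.continuous_fderiv ey)
  rw [torus_eq_prod] at i1 ⊢
  rw [integral_prod _ i1]
  refine integral_eq_zero_of_ae (Eventually.of_forall fun x => ?_)
  have hle : -l ≤ l := by linarith
  simp only [integral_Ico_eq_integral_Ioc, Pi.zero_apply]
  rw [← intervalIntegral.integral_of_le hle, intervalIntegral.integral_const_mul,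
    intervalIntegral.integral_eq_sub_of_hasDerivAt
      (fun y _ => hasDerivAt_snd_section hφ.1 x y), hφ.top_eq_bot, sub_self, mul_zero]
  have : Continuous fun y => fderiv ℝ φ (x, y) ey :=
    (hφ.continuous_fderiv ey).comp (by fun_prop)
  exact this.intervalIntegrable _ _

theorem hasWeakDeriv_ey_of_fst {l : ℝ} (hl : 0 < l) {u : ℝ → ℝ}
    (hi : Integrable (fun p : ℝ × ℝ => u p.1) (torus l)) :
    HasWeakDeriv l ey (fun p => u p.1) 0 :=
  ⟨hi, integrable_zero _ _ _, fun φ hφ => by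
    rw [integral_mul_fderiv_ey hl hi hφ]; simp⟩

theorem memW12_of_lipschitz {l : ℝ} (hl : 0 < l) {K : NNReal} {u : ℝ → ℝ}
    (hu : LipschitzWith K u) (hp : u.Periodic (2 * l)) : MemW12 l (fun p => u p.1) := by
  have h := hasWeakDeriv_ex_of_lipschitz hl hu hp
  have hc : Continuous fun p : ℝ × ℝ => u p.1 := hu.continuous.comp continuous_fst
  obtain ⟨C, hC⟩ := exists_bound_torus hc l
  exact ⟨memLp_torus_of_bound hc.aestronglyMeasurable hC,
    ⟨_, h, memLp_torus_of_bound h.2.1.1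
      (Eventually.of_forall fun p => norm_deriv_le_of_lipschitz hu)⟩,
    ⟨_, hasWeakDeriv_ey_of_fst hl h.1, MemLp.zero⟩⟩

/-! ### Detecting values of a function by test functions -/

/-- The primitive of a mollifier. Differences of its translates are the test functions that read off
values of a function. -/
theorem exists_smooth_step (ρ : ContDiffBump (0 : ℝ)) (h2 : ρ.rOut ≤ 1) :
    ∃ R : ℝ → ℝ, ContDiff ℝ ∞ R ∧ (∀ z, HasDerivAt R (ρ.normed volume z) z) ∧ Monotone R ∧
      (∀ z, z ≤ -ρ.rOut → R z = 0) ∧ (∀ z, ρ.rOut ≤ z → R z = 1) := by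
  -- Since `ρ.rOut ≤ 1`, the base point `-2` lies to the left of the support.
  have hd : ∀ z, HasDerivAt (fun z => ∫ t in (-2 : ℝ)..z, ρ.normed volume t)
      (ρ.normed volume z) z := fun z =>
    intervalIntegral.integral_hasDerivAt_right
      (ρ.continuous_normed.intervalIntegrable _ _)
      (ρ.continuous_normed.stronglyMeasurableAtFilter _ _) ρ.continuous_normed.continuousAt
  have hr := ρ.rOut_pos
  refine ⟨_, ?_, hd, ?_, fun z hz => ?_, fun z hz => ?_⟩
  · rw [contDiff_infty_iff_deriv]
    refine ⟨fun z => (hd z).differentiableAt, ?_⟩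
    rw [funext fun z => (hd z).deriv]
    exact ρ.contDiff_normed
  · exact monotone_of_deriv_nonneg (fun z => (hd z).differentiableAt)
      (fun z => by rw [(hd z).deriv]; exact ρ.nonneg_normed z)
  · refine (intervalIntegral.integral_congr (g := fun _ => 0) fun t ht => ?_).trans (by simp)
    by_contra hne
    have : t ∈ Function.support (ρ.normed volume) := hne
    rw [ρ.support_normed_eq, mem_ball_zero_iff, Real.norm_eq_abs, abs_lt] at this
    rw [mem_uIcc] at ht
    rcases ht with ht | ht <;> linarith [ht.1, ht.2, this.1, this.2]
  · rw [intervalIntegral.integral_eq_integral_of_support_subset, ρ.integral_normed]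
    rw [ρ.support_normed_eq]
    intro t ht
    rw [mem_ball_zero_iff, Real.norm_eq_abs, abs_lt] at ht
    exact ⟨by linarith [ht.1], by linarith [ht.2]⟩

/-- `φ` is a smoothed indicator of `[x, x']`. Its derivative is a mollifier at `x` minus one at
`x'`, so the integral tends to `w x - w x'` wherever the mollifications of `w` converge; `S` is the
set of these points. -/
theorem exists_test_integral_mul_deriv_near {w : ℝ → ℝ} (hw : LocallyIntegrable w volume) :
    ∃ S : Set ℝ, (∀ᵐ x, x ∈ S) ∧ ∀ x ∈ S, ∀ x' ∈ S, x < x' → ∀ a b, a < x → x' < b →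
      ∀ η > 0, ∃ φ : ℝ → ℝ, ContDiff ℝ ∞ φ ∧ HasCompactSupport φ ∧ tsupport φ ⊆ Ioo a b ∧
        (∀ z, |φ z| ≤ 1) ∧ |(∫ z, w z * deriv φ z) - (w x - w x')| < η := by
  have hpos : ∀ m : ℕ, (0 : ℝ) < 1 / ((m : ℝ) + 1) := fun m => by positivity
  -- The ratio of outer to inner radius stays equal to 2; a bound on it is what almost everywhere
  -- convergence of the mollifications requires.
  let ρ : ℕ → ContDiffBump (0 : ℝ) := fun m =>
    ⟨1 / ((m : ℝ) + 1) / 2, 1 / ((m : ℝ) + 1), by have := hpos m; positivity,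
      by linarith [hpos m]⟩
  have hρ : Tendsto (fun m => (ρ m).rOut) atTop (𝓝 0) := tendsto_one_div_add_atTop_nhds_zero_nat
  have hae := ContDiffBump.ae_convolution_tendsto_right_of_locallyIntegrable (μ := volume)
    (φ := ρ) (K := 2) hρ (Eventually.of_forall fun m => by simp only [ρ]; linarith) hw
  refine ⟨_, hae, fun x hx x' hx' hlt a b ha hb η hη => ?_⟩
  have hconv : ∀ m z, (MeasureTheory.convolution ((ρ m).normed volume) w
      (ContinuousLinearMap.lsmul ℝ ℝ) volume) z = ∫ t, w t * (ρ m).normed volume (t - z) := by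
    intro m z
    rw [convolution_lsmul_swap]
    refine integral_congr_ae (Eventually.of_forall fun t => ?_)
    simp only [smul_eq_mul]
    rw [← (ρ m).normed_neg, neg_sub, mul_comm]
  have hlim := (Tendsto.sub hx hx')
  simp only [hconv] at hlim
  have e1 := (Metric.tendsto_nhds.1 hlim η hη)
  have e2 : ∀ᶠ m in atTop, (ρ m).rOut < min (x - a) (b - x') :=
    hρ.eventually_lt_const (lt_min (by linarith) (by linarith))
  obtain ⟨m, hm1, hm2⟩ := (e1.and e2).exists
  have hr1 : (ρ m).rOut ≤ 1 := by
    simp only [ρ]; rw [div_le_one (by positivity)]; linarith [Nat.cast_nonneg (α := ℝ) m]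
  have hr0 := (ρ m).rOut_pos
  set r := (ρ m).rOut
  obtain ⟨R, hRs, hRd, hRm, hR0, hR1⟩ := exists_smooth_step (ρ m) hr1
  have hra : r < x - a := hm2.trans_le (min_le_left _ _)
  have hrb : r < b - x' := hm2.trans_le (min_le_right _ _)
  have h01 : ∀ z, 0 ≤ R z ∧ R z ≤ 1 := fun z => by
    constructor
    · rcases le_total z (-r) with h | h
      · exact (hR0 z h).ge
      · exact (hR0 (-r) le_rfl).ge.trans (hRm h)
    · rcases le_total r z with h | h
      · exact (hR1 z h).le
      · exact (hRm h).trans (hR1 r le_rfl).le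
  have hts : tsupport (fun z => R (z - x) - R (z - x')) ⊆ Icc (x - r) (x' + r) := by
    refine closure_minimal (fun z hz => ?_) isClosed_Icc
    by_contra hno
    apply hz
    rw [mem_Icc, not_and_or, not_le, not_le] at hno
    rcases hno with h | h
    · simp only [hR0 (z - x) (by linarith), hR0 (z - x') (by linarith), sub_zero]
    · simp only [hR1 (z - x) (by linarith), hR1 (z - x') (by linarith), sub_self]
  refine ⟨fun z => R (z - x) - R (z - x'), ?_, ?_, ?_, fun z => ?_, ?_⟩
  · exact (hRs.comp (contDiff_id.sub contDiff_const)).sub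
      (hRs.comp (contDiff_id.sub contDiff_const))
  · exact HasCompactSupport.of_support_subset_isCompact isCompact_Icc
      ((subset_tsupport _).trans hts)
  · exact hts.trans fun z hz => ⟨by linarith [hz.1], by linarith [hz.2]⟩
  · have := hRm (by linarith : z - x' ≤ z - x)
    rw [abs_le]; constructor <;> linarith [h01 (z - x), h01 (z - x')]
  · have hder : ∀ z, deriv (fun z => R (z - x) - R (z - x')) z
        = (ρ m).normed volume (z - x) - (ρ m).normed volume (z - x') := fun z =>
      (((hRd (z - x)).comp_sub_const z x).sub ((hRd (z - x')).comp_sub_const z x')).deriv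
    have hint : ∀ y, Integrable (fun z => w z * (ρ m).normed volume (z - y)) := fun y => by
      have hc : Continuous fun z => (ρ m).normed volume (z - y) :=
        (ρ m).continuous_normed.comp (by fun_prop)
      have hcs : HasCompactSupport fun z => (ρ m).normed volume (z - y) :=
        (ρ m).hasCompactSupport_normed.comp_homeomorph (Homeomorph.subRight y)
      have := hw.integrable_smul_right_of_hasCompactSupport hc hcs
      simpa [smul_eq_mul] using this
    simp only [hder, mul_sub]
    rw [integral_sub (hint x) (hint x')]
    rwa [Real.dist_eq] at hm1

/-- The derivative of a function, extended periodically, integrates against periodic functions as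
the original one. -/
theorem exists_periodic_test {T c : ℝ} (hT : 0 < T) {f : ℝ → ℝ} (hf : ContDiff ℝ ∞ f)
    (hc : HasCompactSupport f) (hs : tsupport f ⊆ Ioo c (c + T)) (hb : ∀ z, |f z| ≤ 1) :
    ∃ φ : ℝ → ℝ, ContDiff ℝ ∞ φ ∧ φ.Periodic T ∧ (∀ z, |φ z| ≤ 1) ∧
      ∀ v : ℝ → ℝ, ∫ x in c..c + T, v x * deriv φ x = ∫ x, v x * deriv f x := by
  obtain ⟨φ, h1, h2, h3, h4⟩ := exists_periodic_eqOn hT hf hc hs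
  refine ⟨φ, h1, h2, fun z => ?_, fun v => ?_⟩
  · obtain ⟨y, hy⟩ := h4 z
    rw [hy]; exact hb y
  · have e : ∫ x in Ioo c (c + T), v x * deriv f x = ∫ x, v x * deriv f x :=
      setIntegral_eq_integral_of_forall_compl_eq_zero fun x hx => by
        have : deriv f x = 0 := by
          by_contra h
          exact hx (hs (support_deriv_subset h))
        rw [this, mul_zero]
    rw [intervalIntegral.integral_of_le (by linarith), integral_Ioc_eq_integral_Ioo, ← e]
    refine setIntegral_congr_fun measurableSet_Ioo fun x hx => ?_
    have : φ =ᶠ[𝓝 x] f := by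
      filter_upwards [Ioo_mem_nhds hx.1 hx.2] with y hy using h3 (Ioo_subset_Ico_self hy)
    simp only [this.deriv_eq]

/-- A function of `x` with vanishing weak derivative is constant. -/
theorem ae_const_of_hasWeakDeriv_zero {l : ℝ} (hl : 0 < l) {u : ℝ → ℝ}
    (hi : IntegrableOn u (Ico (-l) l))
    (h : HasWeakDeriv l ex (fun p => u p.1) 0) :
    ∃ C, ∀ᵐ x ∂(volume.restrict (Ico (-l) l)), u x = C := by
  set w := (Ico (-l) l).indicator u with hwdef
  have hw : LocallyIntegrable w volume :=
    ((integrable_indicator_iff measurableSet_Ico).2 hi).locallyIntegrable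
  obtain ⟨S, hS, hkey⟩ := exists_test_integral_mul_deriv_near hw
  have hlt : ∀ x ∈ S ∩ Ioo (-l) l, ∀ x' ∈ S ∩ Ioo (-l) l, x < x' → w x = w x' := by
    intro x hx x' hx' hxx
    by_contra hne
    have hpos : 0 < |w x - w x'| := abs_pos.2 (sub_ne_zero.2 hne)
    -- The tolerance is the size of the gap itself, so the test integral cannot be zero; the
    -- vanishing weak derivative says that it is.
    obtain ⟨f, hf, hfc, hfs, hfb, hlt⟩ := hkey x hx.1 x' hx'.1 hxx (-l) l hx.2.1 hx'.2.2 _ hpos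
    obtain ⟨φ, hφ, hφp, -, hφv⟩ := exists_periodic_test (T := 2 * l) (by linarith) hf hfc
      (by rwa [show -l + 2 * l = l by ring]) hfb
    have h0 := h.2.2 _ (isTest_fst hφ hφp)
    simp only [fderiv_comp_fst_ex hφ, Pi.zero_apply, zero_mul, integral_zero, neg_zero] at h0
    rw [integral_torus_fst hl (fun x => u x * deriv φ x)] at h0
    have h1 : ∫ x in -l..l, u x * deriv φ x = ∫ x, w x * deriv f x := by
      rw [← hφv w, show -l + 2 * l = l by ring, intervalIntegral.integral_of_le (by linarith),
        intervalIntegral.integral_of_le (by linarith), ← integral_Ico_eq_integral_Ioc,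
        ← integral_Ico_eq_integral_Ioc]
      exact setIntegral_congr_fun measurableSet_Ico fun x hx => by
        simp only [hwdef, indicator_of_mem hx]
    rw [← h1] at hlt
    have : ∫ x in -l..l, u x * deriv φ x = 0 := by
      rcases mul_eq_zero.1 h0 with h | h
      · linarith
      · exact h
    rw [this, zero_sub, abs_neg] at hlt
    exact lt_irrefl _ hlt
  by_cases hne : (S ∩ Ioo (-l) l).Nonempty
  · obtain ⟨x₀, hx₀⟩ := hne
    refine ⟨u x₀, ?_⟩
    rw [Measure.restrict_congr_set Ioo_ae_eq_Ico.symm]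
    filter_upwards [ae_restrict_of_ae hS, ae_restrict_mem measurableSet_Ioo] with x hxS hx
    have : w x = w x₀ := by
      rcases lt_trichotomy x x₀ with h | h | h
      · exact hlt x ⟨hxS, hx⟩ x₀ hx₀ h
      · rw [h]
      · exact (hlt x₀ hx₀ x ⟨hxS, hx⟩ h).symm
    rwa [hwdef, indicator_of_mem (Ioo_subset_Ico_self hx),
      indicator_of_mem (Ioo_subset_Ico_self hx₀.2)] at this
  · refine ⟨0, ?_⟩
    rw [Measure.restrict_congr_set Ioo_ae_eq_Ico.symm]
    filter_upwards [ae_restrict_of_ae hS, ae_restrict_mem measurableSet_Ioo] with x hxS hx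
    exact absurd ⟨x, hxS, hx⟩ hne

/-! ### The jump set of a two-valued function -/

/-- `v` is almost everywhere equal to `s` near `x`. -/
def LocallyEq (v : ℝ → ℝ) (s x : ℝ) : Prop :=
  ∃ η > 0, ∀ᵐ z, z ∈ Ioo (x - η) (x + η) → v z = s

/-- The points near which `v` is not almost everywhere constant. -/
def jumpSet (v : ℝ → ℝ) : Set ℝ := {x | ∀ s, ¬ LocallyEq v s x}

theorem exists_mem_Ioo_of_ae {P : ℝ → Prop} (h : ∀ᵐ z, P z) {a b : ℝ} (hab : a < b) :
    ∃ z ∈ Ioo a b, P z := by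
  by_contra! hno
  have : volume (Ioo a b) = 0 := measure_mono_null (fun z hz => hno z hz) h
  rw [Real.volume_Ioo] at this
  simp only [ENNReal.ofReal_eq_zero] at this
  linarith

theorem LocallyEq.unique {v : ℝ → ℝ} {s s' x : ℝ} (h : LocallyEq v s x)
    (h' : LocallyEq v s' x) : s = s' := by
  obtain ⟨η, hη, h1⟩ := h
  obtain ⟨η', hη', h2⟩ := h'
  have hm : 0 < min η η' := lt_min hη hη'
  obtain ⟨z, hz, hz1, hz2⟩ := exists_mem_Ioo_of_ae (h1.and h2)
    (by linarith : x - min η η' < x + min η η')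
  have e1 := min_le_left η η'
  have e2 := min_le_right η η'
  rw [← hz1 ⟨by linarith [hz.1], by linarith [hz.2]⟩, hz2 ⟨by linarith [hz.1], by linarith [hz.2]⟩]

theorem LocallyEq.of_ae_Ioo {v : ℝ → ℝ} {s a b x : ℝ} (h : ∀ᵐ z, z ∈ Ioo a b → v z = s)
    (hx : x ∈ Ioo a b) : LocallyEq v s x := by
  refine ⟨min (x - a) (b - x), lt_min (by linarith [hx.1]) (by linarith [hx.2]), ?_⟩
  filter_upwards [h] with z hz hz'
  have e1 := min_le_left (x - a) (b - x)
  have e2 := min_le_right (x - a) (b - x)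
  exact hz ⟨by linarith [hz'.1], by linarith [hz'.2]⟩

theorem LocallyEq.eq_or {v : ℝ → ℝ} (hv : ∀ x, v x = 1 ∨ v x = -1) {s x : ℝ}
    (h : LocallyEq v s x) : s = 1 ∨ s = -1 := by
  obtain ⟨η, hη, h1⟩ := h
  obtain ⟨z, hz, hz1⟩ := exists_mem_Ioo_of_ae h1 (by linarith : x - η < x + η)
  rw [← hz1 hz]; exact hv z

theorem isOpen_locallyEq (v : ℝ → ℝ) (s : ℝ) : IsOpen {x | LocallyEq v s x} := by
  rw [isOpen_iff_mem_nhds]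
  rintro x ⟨η, hη, h⟩
  filter_upwards [Ioo_mem_nhds (by linarith : x - η < x) (by linarith : x < x + η)] with y hy
  exact LocallyEq.of_ae_Ioo h hy

/-- The exceptional null set in `LocallyEq` depends on the point; intervals with rational endpoints
reduce it to countably many. -/
theorem ae_eq_of_locallyEq (v : ℝ → ℝ) (s : ℝ) : ∀ᵐ x, LocallyEq v s x → v x = s := by
  have h : ∀ q : ℚ × ℚ, ∀ᵐ x : ℝ, (∀ᵐ z : ℝ, z ∈ Ioo (q.1 : ℝ) q.2 → v z = s) →
      x ∈ Ioo (q.1 : ℝ) q.2 → v x = s := fun q => by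
    by_cases hq : ∀ᵐ z : ℝ, z ∈ Ioo (q.1 : ℝ) q.2 → v z = s
    · filter_upwards [hq] with x hx _ using hx
    · exact Eventually.of_forall fun x hx => absurd hx hq
  filter_upwards [ae_all_iff.2 h] with x hx hloc
  obtain ⟨η, hη, h1⟩ := hloc
  obtain ⟨q, hq1, hq2⟩ := exists_rat_btwn (by linarith : x - η < x)
  obtain ⟨r, hr1, hr2⟩ := exists_rat_btwn (by linarith : x < x + η)
  refine hx (q, r) ?_ ⟨hq2, hr1⟩
  filter_upwards [h1] with z hz hz'
  exact hz ⟨hq1.trans hz'.1, hz'.2.trans hr2⟩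

/-- Connectedness: the points near which `v` is `1` and those near which it is `-1` form disjoint
open sets covering the interval. -/
theorem exists_ae_eq_on_Ioo {v : ℝ → ℝ} (hv : ∀ x, v x = 1 ∨ v x = -1) {a b : ℝ}
    (h : ∀ x ∈ Ioo a b, x ∉ jumpSet v) :
    ∃ s, (s = 1 ∨ s = -1) ∧ ∀ᵐ z, z ∈ Ioo a b → v z = s := by
  have hd : Disjoint {x | LocallyEq v 1 x} {x | LocallyEq v (-1) x} := by
    rw [Set.disjoint_left]
    intro x h1 h2
    have := LocallyEq.unique h1 h2
    norm_num at this
  have hcov : Ioo a b ⊆ {x | LocallyEq v 1 x} ∪ {x | LocallyEq v (-1) x} := fun x hx => by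
    have := h x hx
    simp only [jumpSet, mem_ofPred_eq, not_forall, not_not] at this
    obtain ⟨s, hs⟩ := this
    rcases hs.eq_or hv with rfl | rfl
    · exact Or.inl hs
    · exact Or.inr hs
  rcases isPreconnected_Ioo.subset_or_subset (isOpen_locallyEq v 1) (isOpen_locallyEq v (-1))
    hd hcov with h1 | h1
  · refine ⟨1, Or.inl rfl, ?_⟩
    filter_upwards [ae_eq_of_locallyEq v 1] with z hz hz' using hz (h1 hz')
  · refine ⟨-1, Or.inr rfl, ?_⟩
    filter_upwards [ae_eq_of_locallyEq v (-1)] with z hz hz' using hz (h1 hz')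

theorem ae_add_right {P : ℝ → Prop} (h : ∀ᵐ z, P z) (a : ℝ) : ∀ᵐ z, P (z + a) :=
  (measurePreserving_add_right volume a).quasiMeasurePreserving.ae h

theorem LocallyEq.sub_period {v : ℝ → ℝ} {T s x : ℝ} (hp : v.Periodic T)
    (h : LocallyEq v s (x + T)) : LocallyEq v s x := by
  obtain ⟨η, hη, h1⟩ := h
  refine ⟨η, hη, ?_⟩
  filter_upwards [ae_add_right h1 T] with z hz hz'
  rw [← hp z]
  exact hz ⟨by linarith [hz'.1], by linarith [hz'.2]⟩

theorem LocallyEq.add_period {v : ℝ → ℝ} {T s x : ℝ} (hp : v.Periodic T)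
    (h : LocallyEq v s x) : LocallyEq v s (x + T) := by
  obtain ⟨η, hη, h1⟩ := h
  refine ⟨η, hη, ?_⟩
  filter_upwards [ae_add_right h1 (-T)] with z hz hz'
  have := hp (z + -T)
  rw [neg_add_cancel_right] at this
  rw [this]
  exact hz ⟨by linarith [hz'.1], by linarith [hz'.2]⟩

theorem add_mem_jumpSet_iff {v : ℝ → ℝ} {T x : ℝ} (hp : v.Periodic T) :
    x + T ∈ jumpSet v ↔ x ∈ jumpSet v :=
  ⟨fun h s hs => h s (hs.add_period hp), fun h s hs => h s (hs.sub_period hp)⟩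

/-- The factor 4 leaves room for box averages: for `x` within `δ` of a jump `t`, the box of radius
`δ` stays within `2 * δ` of `t` and meets no other jump. -/
theorem exists_separation (F : Finset ℝ) :
    ∃ δ > 0, ∀ x ∈ F, ∀ y ∈ F, x ≠ y → 4 * δ ≤ |x - y| := by
  by_cases h : F.offDiag.Nonempty
  · obtain ⟨p, hp, hmin⟩ := F.offDiag.exists_min_image (fun p => |p.1 - p.2|) h
    rw [Finset.mem_offDiag] at hp
    have : 0 < |p.1 - p.2| := abs_pos.2 (sub_ne_zero.2 hp.2.2)
    refine ⟨|p.1 - p.2| / 4, by positivity, fun x hx y hy hxy => ?_⟩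
    have := hmin (x, y) (Finset.mem_offDiag.2 ⟨hx, hy, hxy⟩)
    linarith
  · refine ⟨1, one_pos, fun x hx y hy hxy => absurd ⟨(x, y), ?_⟩ h⟩
    exact Finset.mem_offDiag.2 ⟨hx, hy, hxy⟩

theorem locallyIntegrable_of_two_valued {v : ℝ → ℝ} (hm : Measurable v)
    (hv : ∀ x, v x = 1 ∨ v x = -1) : LocallyIntegrable v volume := by
  refine (locallyIntegrable_const (1 : ℝ)).mono hm.aestronglyMeasurable
    (Eventually.of_forall fun x => ?_)
  rcases hv x with h | h <;> simp [h]

/-- Arbitrarily close to a jump, `v` takes both values at points of the full-measure set where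
values are detected. Their difference is 2; the sign of `f` is chosen according to which value comes
first. -/
theorem exists_local_test {v : ℝ → ℝ} (hm : Measurable v) (hv : ∀ x, v x = 1 ∨ v x = -1)
    {t : ℝ} (ht : t ∈ jumpSet v) {δ η : ℝ} (hδ : 0 < δ) (hη : 0 < η) :
    ∃ f : ℝ → ℝ, ContDiff ℝ ∞ f ∧ HasCompactSupport f ∧ tsupport f ⊆ Ioo (t - δ) (t + δ) ∧
      (∀ z, |f z| ≤ 1) ∧ 2 - η < ∫ z, v z * deriv f z := by
  obtain ⟨S, hS, hkey⟩ := exists_test_integral_mul_deriv_near (locallyIntegrable_of_two_valued hm hv)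
  have hex : ∀ s, ∃ z ∈ S, z ∈ Ioo (t - δ) (t + δ) ∧ v z ≠ s := fun s => by
    by_contra! hno
    exact ht s ⟨δ, hδ, hS.mono fun z hz hz' => hno z hz hz'⟩
  obtain ⟨y, hyS, hyI, hy⟩ := hex (-1)
  obtain ⟨y', hyS', hyI', hy'⟩ := hex 1
  have e1 : v y = 1 := (hv y).resolve_right hy
  have e2 : v y' = -1 := (hv y').resolve_left hy'
  rcases lt_trichotomy y y' with h | h | h
  · obtain ⟨f, h1, h2, h3, h4, h5⟩ := hkey y hyS y' hyS' h _ _ hyI.1 hyI'.2 η hη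
    refine ⟨f, h1, h2, h3, h4, ?_⟩
    rw [e1, e2, abs_lt] at h5
    linarith [h5.1]
  · rw [h, e2] at e1; norm_num at e1
  · obtain ⟨f, h1, h2, h3, h4, h5⟩ := hkey y' hyS' y hyS h _ _ hyI'.1 hyI.2 η hη
    refine ⟨fun z => -f z, h1.neg, h2.neg, ?_, fun z => by rw [abs_neg]; exact h4 z, ?_⟩
    · exact (closure_mono (by rw [Function.support_fun_neg])).trans h3
    · have : deriv (fun z => -f z) = fun z => -deriv f z := by
        ext z; simp
      rw [e1, e2, abs_lt] at h5
      simp only [this, mul_neg, integral_neg]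
      linarith [h5.2]

/-- Local test functions at different jumps have disjoint supports, so their sum is still bounded by
1 while the contributions add up. -/
theorem exists_test_of_finset {v : ℝ → ℝ} (hm : Measurable v) (hv : ∀ x, v x = 1 ∨ v x = -1)
    {T c : ℝ} (hT : 0 < T) {F : Finset ℝ} (hF : ∀ t ∈ F, t ∈ jumpSet v)
    (hFc : ∀ t ∈ F, t ∈ Ioo c (c + T)) {η : ℝ} (hη : 0 < η) :
    ∃ φ : ℝ → ℝ, ContDiff ℝ ∞ φ ∧ φ.Periodic T ∧ (∀ z, |φ z| ≤ 1) ∧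
      2 * F.card - η < ∫ x in c..c + T, v x * deriv φ x := by
  classical
  -- Including the endpoints of the period keeps the supports inside it.
  obtain ⟨δ, hδ, hsep⟩ := exists_separation (insert c (insert (c + T) F))
  -- The `+ 1` covers empty `F` and keeps the total error strictly below `η`.
  have hη' : 0 < η / (F.card + 1) := by positivity
  have hch : ∀ t : ℝ, ∃ f : ℝ → ℝ, t ∈ F → ContDiff ℝ ∞ f ∧ HasCompactSupport f ∧
      tsupport f ⊆ Ioo (t - δ) (t + δ) ∧ (∀ z, |f z| ≤ 1) ∧
      2 - η / (F.card + 1) < ∫ z, v z * deriv f z := fun t => by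
    by_cases ht : t ∈ F
    · obtain ⟨f, hf⟩ := exists_local_test hm hv (hF t ht) hδ hη'
      exact ⟨f, fun _ => hf⟩
    · exact ⟨0, fun h => absurd h ht⟩
  choose f hf using hch
  have hz : ∀ t ∈ F, ∀ z, f t z ≠ 0 → |z - t| < δ := fun t ht z hz => by
    have := (hf t ht).2.2.1 (subset_tsupport _ hz)
    rw [abs_lt]; exact ⟨by linarith [this.1], by linarith [this.2]⟩
  have hsub : Function.support (fun z => ∑ t ∈ F, f t z) ⊆ ⋃ t ∈ F, tsupport (f t) := by
    intro z hz
    obtain ⟨t, ht, htz⟩ := Finset.exists_ne_zero_of_sum_ne_zero hz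
    exact mem_biUnion ht (subset_tsupport _ htz)
  have hcl : IsCompact (⋃ t ∈ F, tsupport (f t)) :=
    F.isCompact_biUnion fun t ht => (hf t ht).2.1
  have hts : tsupport (fun z => ∑ t ∈ F, f t z) ⊆ ⋃ t ∈ F, tsupport (f t) :=
    closure_minimal hsub hcl.isClosed
  obtain ⟨φ, h1, h2, h3, h4⟩ := exists_periodic_test (c := c) hT (f := fun z => ∑ t ∈ F, f t z)
    (ContDiff.sum fun t ht => (hf t ht).1)
    (HasCompactSupport.of_support_subset_isCompact hcl hsub)
    (hts.trans (by
      refine iUnion₂_subset fun t ht => (hf t ht).2.2.1.trans fun z hz => ?_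
      have e1 := hsep t (by simp [ht]) c (by simp) (hFc t ht).1.ne'
      have e2 := hsep t (by simp [ht]) (c + T) (by simp) (hFc t ht).2.ne
      rw [abs_of_pos (by linarith [(hFc t ht).1])] at e1
      rw [abs_of_neg (by linarith [(hFc t ht).2])] at e2
      exact ⟨by linarith [hz.1], by linarith [hz.2]⟩))
    (fun z => by
      by_cases hex : ∃ t ∈ F, f t z ≠ 0
      · obtain ⟨t, ht, htz⟩ := hex
        rw [Finset.sum_eq_single t]
        · exact (hf t ht).2.2.2.1 z
        · intro t' ht' hne
          by_contra hcon
          have e1 := hz t ht z htz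
          have e2 := hz t' ht' z hcon
          have e3 := hsep t (by simp [ht]) t' (by simp [ht']) hne.symm
          have := abs_sub_le t z t'
          rw [abs_sub_comm t z] at this
          linarith
        · exact fun h => absurd ht h
      · push Not at hex
        rw [Finset.sum_eq_zero hex]; simp)
  refine ⟨φ, h1, h2, h3, ?_⟩
  have hder : ∀ z, deriv (fun z => ∑ t ∈ F, f t z) z = ∑ t ∈ F, deriv (f t) z := fun z =>
    deriv_fun_sum fun t ht => ((hf t ht).1.differentiable (by simp)) z
  rw [h4]
  simp only [hder, Finset.mul_sum]
  rw [integral_finsetSum]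
  · have : ∑ t ∈ F, (2 - η / (F.card + 1)) ≤ ∑ t ∈ F, ∫ z, v z * deriv (f t) z :=
      Finset.sum_le_sum fun t ht => (hf t ht).2.2.2.2.le
    rw [Finset.sum_const, nsmul_eq_mul] at this
    refine lt_of_lt_of_le ?_ this
    have : (F.card : ℝ) * (η / (F.card + 1)) < η := by
      rw [mul_div_assoc', div_lt_iff₀ (by positivity)]
      nlinarith
    linarith
  · intro t ht
    have hc : Continuous (deriv (f t)) := (hf t ht).1.continuous_deriv (by simp)
    have := (locallyIntegrable_of_two_valued hm hv).integrable_smul_right_of_hasCompactSupport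
      hc (hf t ht).2.1.deriv
    simpa [smul_eq_mul] using this

/-! ### Box averages -/

/-- Half the integral of `v` over the interval of radius `δ` around `x`. If `v = ±1` has isolated
jumps, this is the signed distance from the jumps truncated at `±δ`. -/
noncomputable def boxAvg (v : ℝ → ℝ) (δ x : ℝ) : ℝ := 1 / 2 * ∫ z in (x - δ)..(x + δ), v z

theorem intervalIntegrable_of_two_valued {v : ℝ → ℝ} (hm : Measurable v)
    (hv : ∀ x, v x = 1 ∨ v x = -1) (a b : ℝ) : IntervalIntegrable v volume a b :=
  intervalIntegrable_iff.mpr <|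
    ((locallyIntegrable_of_two_valued hm hv).integrableOn_isCompact isCompact_uIcc).mono_set
      uIoc_subset_uIcc

theorem abs_integral_le_of_two_valued {v : ℝ → ℝ} (hv : ∀ x, v x = 1 ∨ v x = -1) (a b : ℝ) :
    |∫ z in a..b, v z| ≤ |b - a| := by
  have := intervalIntegral.norm_integral_le_of_norm_le_const (a := a) (b := b) (f := v) (C := 1)
    fun x _ => by rcases hv x with h | h <;> simp [h]
  simpa using this

theorem boxAvg_lipschitz {v : ℝ → ℝ} (hm : Measurable v) (hv : ∀ x, v x = 1 ∨ v x = -1) (δ : ℝ) :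
    LipschitzWith 1 (boxAvg v δ) := by
  refine LipschitzWith.of_dist_le_mul fun x y => ?_
  have i := intervalIntegrable_of_two_valued hm hv
  have e : boxAvg v δ x - boxAvg v δ y
      = 1 / 2 * ((∫ z in (y + δ)..(x + δ), v z) - ∫ z in (y - δ)..(x - δ), v z) := by
    have h1 := intervalIntegral.integral_add_adjacent_intervals (i (y - δ) (x - δ))
      (i (x - δ) (x + δ))
    have h2 := intervalIntegral.integral_add_adjacent_intervals (i (y - δ) (y + δ))
      (i (y + δ) (x + δ))
    simp only [boxAvg]
    linarith
  have a1 := abs_integral_le_of_two_valued hv (y + δ) (x + δ)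
  have a2 := abs_integral_le_of_two_valued hv (y - δ) (x - δ)
  rw [show x + δ - (y + δ) = x - y by ring] at a1
  rw [show x - δ - (y - δ) = x - y by ring] at a2
  rw [Real.dist_eq, Real.dist_eq, e, abs_mul, abs_of_pos (by norm_num : (0 : ℝ) < 1 / 2)]
  have := abs_sub (∫ z in (y + δ)..(x + δ), v z) (∫ z in (y - δ)..(x - δ), v z)
  simp only [NNReal.coe_one, one_mul]
  linarith

theorem abs_boxAvg_le {v : ℝ → ℝ} (hv : ∀ x, v x = 1 ∨ v x = -1) {δ : ℝ} (hδ : 0 < δ) (x : ℝ) :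
    |boxAvg v δ x| ≤ δ := by
  have a1 := abs_integral_le_of_two_valued hv (x - δ) (x + δ)
  rw [show x + δ - (x - δ) = 2 * δ by ring, abs_of_pos (by linarith : 0 < 2 * δ)] at a1
  rw [boxAvg, abs_mul, abs_of_pos (by norm_num : (0 : ℝ) < 1 / 2)]
  linarith

theorem boxAvg_periodic {v : ℝ → ℝ} {T : ℝ} (hp : v.Periodic T) (δ : ℝ) :
    (boxAvg v δ).Periodic T := fun x => by
  have := intervalIntegral.integral_comp_add_right (a := x - δ) (b := x + δ) v T
  simp only [hp _] at this
  rw [boxAvg, boxAvg, this]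
  congr 2 <;> ring

theorem boxAvg_eq_of_ae {v : ℝ → ℝ} (hm : Measurable v) (hv : ∀ x, v x = 1 ∨ v x = -1)
    {δ s₁ s₂ m x : ℝ} (h1 : ∀ᵐ z, z ∈ Ioo (x - δ) m → v z = s₁)
    (h2 : ∀ᵐ z, z ∈ Ioo m (x + δ) → v z = s₂) (hm1 : x - δ ≤ m) (hm2 : m ≤ x + δ) :
    boxAvg v δ x = 1 / 2 * (s₁ * (m - x + δ) + s₂ * (x + δ - m)) := by
  have i := intervalIntegrable_of_two_valued hm hv
  have aux : ∀ {a b s : ℝ}, a ≤ b → (∀ᵐ z, z ∈ Ioo a b → v z = s) →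
      ∫ z in a..b, v z = s * (b - a) := fun {a b s} hab h => by
    rw [intervalIntegral.integral_of_le hab, integral_Ioc_eq_integral_Ioo,
      setIntegral_congr_ae (g := fun _ => s) measurableSet_Ioo h, setIntegral_const,
      Real.volume_real_Ioo_of_le hab, smul_eq_mul, mul_comm]
  rw [boxAvg, ← intervalIntegral.integral_add_adjacent_intervals (i (x - δ) m) (i m (x + δ)),
    aux hm1 h1, aux hm2 h2]
  ring

/-- The properties of the truncated signed distance `D` from the `k` jumps (in each period) of a
periodic function `v = ±1`. -/
structure IsTruncDist (l : ℝ) (v : ℝ → ℝ) (k : ℕ) (δ a : ℝ) (D : ℝ → ℝ) : Prop where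
  δ_pos : 0 < δ
  a_nonneg : 0 ≤ a
  lipschitz : LipschitzWith 1 D
  periodic : D.Periodic (2 * l)
  bound : ∀ x, |D x| ≤ δ
  sign : ∀ᵐ x, 0 < v x * D x
  law : ∀ f : ℝ → ℝ, IntervalIntegrable f volume (-δ) δ →
    IntervalIntegrable (fun x => f (D x)) volume (-l) l ∧
      ∫ x in -l..l, f (D x) = k * (∫ r in -δ..δ, f r) + a * (f δ + f (-δ))
  deriv_sq : ∀ x, deriv D x ^ 2 = if |D x| < δ then 1 else 0

theorem ae_of_periodic {T c : ℝ} (hT : 0 < T) {P : ℝ → Prop} (hP : ∀ x, P (x + T) ↔ P x)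
    (h : ∀ᵐ x, x ∈ Ico c (c + T) → P x) : ∀ᵐ x, P x := by
  have hZ : ∀ (m : ℤ) (x : ℝ), P (x + m • T) ↔ P x := by
    have : Function.Periodic P T := fun x => propext (hP x)
    intro m x
    rw [this.zsmul m x]
  filter_upwards [ae_all_iff.2 fun m : ℤ => ae_add_right h (m • T)] with x hx
  have := hx (-toIcoDiv hT c x)
  rw [hZ] at this
  refine this ?_
  have h := sub_toIcoDiv_zsmul_mem_Ico hT c x
  rwa [sub_eq_add_neg, ← neg_zsmul] at h

theorem sign_integrable (δ : ℝ) : IntervalIntegrable (fun r : ℝ => r / |r|) volume (-δ) δ := by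
  refine (intervalIntegrable_const (c := (1 : ℝ))).mono_fun ?_ (Eventually.of_forall fun r => ?_)
  · exact (measurable_id.div (measurable_id.norm)).aestronglyMeasurable
  · simp only [norm_div, Real.norm_eq_abs, abs_abs]
    simpa using div_self_le_one |r|

theorem integral_of_odd {f : ℝ → ℝ} (hf : ∀ r, f (-r) = -f r) (δ : ℝ) :
    ∫ r in -δ..δ, f r = 0 := by
  have := intervalIntegral.integral_comp_neg (a := -δ) (b := δ) f
  simp only [hf, neg_neg, intervalIntegral.integral_neg] at this
  linarith

/-! ### The box average when `δ` is small compared with the distances between jumps -/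

section Window

variable {v : ℝ → ℝ} {l c δ : ℝ} {F : Finset ℝ}

/-- Near a jump the box average is, up to sign, the signed distance. -/
theorem boxAvg_near_jump (hm : Measurable v) (hv : ∀ x, v x = 1 ∨ v x = -1)
    (hFJ : ∀ t, t ∈ F ↔ t ∈ jumpSet v ∧ t ∈ Ioo c (c + 2 * l))
    (hδ : 0 < δ) (hsep : ∀ x ∈ insert c (insert (c + 2 * l) F),
      ∀ y ∈ insert c (insert (c + 2 * l) F), x ≠ y → 4 * δ ≤ |x - y|) {t : ℝ} (ht : t ∈ F) :
    c + 4 * δ ≤ t ∧ t + 4 * δ ≤ c + 2 * l ∧ ∃ s, (s = 1 ∨ s = -1) ∧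
      (∀ᵐ z, z ∈ Ioo (t - 2 * δ) t → v z = -s) ∧ (∀ᵐ z, z ∈ Ioo t (t + 2 * δ) → v z = s) ∧
      ∀ x, |x - t| ≤ δ → boxAvg v δ x = s * (x - t) := by
  obtain ⟨htJ, htc⟩ := (hFJ t).1 ht
  have e1 := hsep t (by simp [ht]) c (by simp) htc.1.ne'
  have e2 := hsep t (by simp [ht]) (c + 2 * l) (by simp) htc.2.ne
  rw [abs_of_pos (by linarith [htc.1])] at e1
  rw [abs_of_neg (by linarith [htc.2])] at e2
  have hno : ∀ x, |x - t| < 2 * δ → x ≠ t → x ∉ jumpSet v := fun x hx hne hxJ => by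
    have hx' := abs_lt.1 hx
    have hxF : x ∈ F := (hFJ x).2 ⟨hxJ, by linarith, by linarith⟩
    have := hsep x (by simp [hxF]) t (by simp [ht]) hne
    linarith
  obtain ⟨s₁, hs₁, h1⟩ := exists_ae_eq_on_Ioo hv (a := t - 2 * δ) (b := t) fun x hx =>
    hno x (by rw [abs_lt]; constructor <;> linarith [hx.1, hx.2]) hx.2.ne
  obtain ⟨s₂, hs₂, h2⟩ := exists_ae_eq_on_Ioo hv (a := t) (b := t + 2 * δ) fun x hx =>
    hno x (by rw [abs_lt]; constructor <;> linarith [hx.1, hx.2]) hx.1.ne'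
  -- If the values on both sides agreed, `v` would be almost everywhere constant near `t`, a single
  -- point being null.
  have hne : s₁ ≠ s₂ := by
    rintro rfl
    refine htJ s₁ ⟨2 * δ, by linarith, ?_⟩
    filter_upwards [h1, h2, (measure_eq_zero_iff_ae_notMem.1 (measure_singleton t))]
      with z hz1 hz2 hzt hz
    rcases lt_trichotomy z t with h | h | h
    · exact hz1 ⟨hz.1, h⟩
    · exact absurd h hzt
    · exact hz2 ⟨h, hz.2⟩
  have hs : s₁ = -s₂ := by
    rcases hs₁ with rfl | rfl <;> rcases hs₂ with rfl | rfl <;> simp_all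
  refine ⟨by linarith, by linarith, s₂, hs₂, hs ▸ h1, h2, fun x hx => ?_⟩
  have hx' := abs_le.1 hx
  rw [boxAvg_eq_of_ae hm hv (m := t) (s₁ := s₁) (s₂ := s₂), hs]
  · ring
  · filter_upwards [h1] with z hz hz' using hz ⟨by linarith [hz'.1], hz'.2⟩
  · filter_upwards [h2] with z hz hz' using hz ⟨hz'.1, by linarith [hz'.2]⟩
  · linarith
  · linarith

/-- No jump lies in the box around `x`. Where the box leaves the window, a jump would reappear,
translated by a period, within `δ` of the other end, although jumps keep distance `4 * δ` from both
ends. -/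
theorem boxAvg_far_from_jumps (hm : Measurable v) (hv : ∀ x, v x = 1 ∨ v x = -1)
    (hp : v.Periodic (2 * l)) (hl : 0 < l) (hc : c ∉ jumpSet v)
    (hFJ : ∀ t, t ∈ F ↔ t ∈ jumpSet v ∧ t ∈ Ioo c (c + 2 * l))
    (hδ : 0 < δ) (hsep : ∀ x ∈ insert c (insert (c + 2 * l) F),
      ∀ y ∈ insert c (insert (c + 2 * l) F), x ≠ y → 4 * δ ≤ |x - y|) {x : ℝ}
    (hx : x ∈ Icc c (c + 2 * l)) (hfar : ∀ t ∈ F, δ ≤ |x - t|) :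
    ∃ s, (s = 1 ∨ s = -1) ∧ LocallyEq v s x ∧ boxAvg v δ x = s * δ := by
  have hcl : 4 * δ ≤ 2 * l := by
    have := hsep (c + 2 * l) (by simp) c (by simp) (by linarith)
    rwa [abs_of_pos (by linarith), add_sub_cancel_left] at this
  have hno : ∀ y ∈ Ioo (x - δ) (x + δ), y ∉ jumpSet v := fun y hy hyJ => by
    have hF : ∀ t ∈ F, c + 4 * δ ≤ t ∧ t + 4 * δ ≤ c + 2 * l := fun t ht =>
      let h := boxAvg_near_jump hm hv hFJ hδ hsep ht
      ⟨h.1, h.2.1⟩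
    have hyc : y ≠ c := fun h => hc (h ▸ hyJ)
    have hyc' : y ≠ c + 2 * l := fun h => hc ((add_mem_jumpSet_iff hp).1 (h ▸ hyJ))
    rcases lt_or_gt_of_ne hyc with h | h
    · have := hF (y + 2 * l) ((hFJ _).2 ⟨(add_mem_jumpSet_iff hp).2 hyJ, by
        linarith [hy.1, hx.1], by linarith⟩)
      linarith [hy.1, hx.1]
    rcases lt_or_gt_of_ne hyc' with h' | h'
    · have hyF := (hFJ y).2 ⟨hyJ, h, h'⟩
      have := hfar y hyF
      have h3 : |x - y| < δ := abs_lt.2 ⟨by linarith [hy.2], by linarith [hy.1]⟩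
      linarith
    · have hyJ' : y - 2 * l ∈ jumpSet v := by
        rw [← add_mem_jumpSet_iff hp, sub_add_cancel]; exact hyJ
      have := hF (y - 2 * l) ((hFJ _).2 ⟨hyJ', by linarith, by linarith [hy.2, hx.2]⟩)
      linarith [hy.2, hx.2]
  obtain ⟨s, hs, h⟩ := exists_ae_eq_on_Ioo hv hno
  refine ⟨s, hs, ⟨δ, hδ, h⟩, ?_⟩
  rw [boxAvg_eq_of_ae hm hv (m := x) (s₁ := s) (s₂ := s)]
  · ring
  · filter_upwards [h] with z hz hz' using hz ⟨hz'.1, by linarith [hz'.2]⟩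
  · filter_upwards [h] with z hz hz' using hz ⟨by linarith [hz'.1], hz'.2⟩
  · linarith
  · linarith

/-- The image of Lebesgue measure under `D`: each layer `|x - t| ≤ δ` is mapped with slope `±1` onto
`[-δ, δ]`, and the rest of the window consists of the plateaus `D = δ` and `D = -δ`, whose measures
are `a` and `b`. -/
theorem boxAvg_law_window (hm : Measurable v) (hv : ∀ x, v x = 1 ∨ v x = -1)
    (hp : v.Periodic (2 * l)) (hl : 0 < l) (hc : c ∉ jumpSet v)
    (hFJ : ∀ t, t ∈ F ↔ t ∈ jumpSet v ∧ t ∈ Ioo c (c + 2 * l))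
    (hδ : 0 < δ) (hsep : ∀ x ∈ insert c (insert (c + 2 * l) F),
      ∀ y ∈ insert c (insert (c + 2 * l) F), x ≠ y → 4 * δ ≤ |x - y|) :
    ∃ a b : ℝ, 0 ≤ a ∧ ∀ f : ℝ → ℝ, IntervalIntegrable f volume (-δ) δ →
      IntervalIntegrable (fun x => f (boxAvg v δ x)) volume c (c + 2 * l) ∧
      ∫ x in c..c + 2 * l, f (boxAvg v δ x)
        = F.card * (∫ r in -δ..δ, f r) + (a * f δ + b * f (-δ)) := by
  set D := boxAvg v δ with hD
  have hDc : Continuous D := (boxAvg_lipschitz hm hv δ).continuous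
  set L : Set ℝ := ⋃ t ∈ F, Icc (t - δ) (t + δ) with hL
  have hLm : MeasurableSet L := F.measurableSet_biUnion fun t _ => measurableSet_Icc
  set Rp := (Ioc c (c + 2 * l) \ L) ∩ {x | D x = δ} with hRp
  set Rm := (Ioc c (c + 2 * l) \ L) ∩ {x | D x = -δ} with hRm
  have hRpm : MeasurableSet Rp := (measurableSet_Ioc.diff hLm).inter
    (isClosed_eq hDc continuous_const).measurableSet
  have hRmm : MeasurableSet Rm := (measurableSet_Ioc.diff hLm).inter
    (isClosed_eq hDc continuous_const).measurableSet
  have hR : Ioc c (c + 2 * l) \ L = Rp ∪ Rm := by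
    rw [hRp, hRm, ← inter_union_distrib_left]
    refine (inter_eq_left.2 fun x hx => ?_).symm
    obtain ⟨s, hs, -, hxs⟩ := boxAvg_far_from_jumps hm hv hp hl hc hFJ hδ hsep
      (Ioc_subset_Icc_self hx.1) (fun t ht => by
        by_contra hlt
        rw [not_le, abs_lt] at hlt
        exact hx.2 (mem_biUnion ht ⟨by linarith [hlt.1], by linarith [hlt.2]⟩))
    rcases hs with rfl | rfl
    · left; rw [one_mul] at hxs; exact hxs
    · right; rw [neg_one_mul] at hxs; exact hxs
  have hdisj : Disjoint Rp Rm := by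
    rw [Set.disjoint_left]
    rintro x ⟨-, h1⟩ ⟨-, h2⟩
    have h1 : D x = δ := h1
    have h2 : D x = -δ := h2
    linarith
  have hLsub : L ⊆ Ioc c (c + 2 * l) := iUnion₂_subset fun t ht x hx => by
    have h := boxAvg_near_jump hm hv hFJ hδ hsep ht
    exact ⟨by linarith [hx.1, h.1], by linarith [hx.2, h.2.1]⟩
  have hfin : ∀ s ⊆ Ioc c (c + 2 * l), volume s ≠ ⊤ := fun s hs =>
    ((measure_mono hs).trans_lt measure_Ioc_lt_top).ne
  refine ⟨volume.real Rp, volume.real Rm, measureReal_nonneg, fun f hf => ?_⟩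
  have hlay : ∀ t ∈ F, IntegrableOn (fun x => f (D x)) (Icc (t - δ) (t + δ)) ∧
      ∫ x in Icc (t - δ) (t + δ), f (D x) = ∫ r in -δ..δ, f r := fun t ht => by
    obtain ⟨-, -, s, hs, -, -, hxs⟩ := boxAvg_near_jump hm hv hFJ hδ hsep ht
    have hcg : EqOn (fun x => f (D x)) (fun x => f (s * (x - t))) (Icc (t - δ) (t + δ)) :=
      fun x hx => by
        simp only [hD]
        rw [hxs x (abs_le.2 ⟨by linarith [hx.1], by linarith [hx.2]⟩)]
    have hfs : IntervalIntegrable (fun r => f (s * r)) volume (-δ) δ ∧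
        ∫ r in -δ..δ, f (s * r) = ∫ r in -δ..δ, f r := by
      rcases hs with rfl | rfl
      · simpa using hf
      · simp only [neg_one_mul]
        refine ⟨?_, ?_⟩
        · have := (IntervalIntegrable.iff_comp_neg (f := f)).1 hf.symm
          rwa [neg_neg] at this
        · simp
    have hle : t - δ ≤ t + δ := by linarith
    constructor
    · refine IntegrableOn.congr_fun ?_ hcg.symm measurableSet_Icc
      have := hfs.1.comp_sub_right t
      rw [integrableOn_Icc_iff_integrableOn_Ioc, ← intervalIntegrable_iff_integrableOn_Ioc_of_le hle]
      rwa [show -δ + t = t - δ by ring, show δ + t = t + δ by ring] at this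
    · rw [setIntegral_congr_fun measurableSet_Icc hcg, integral_Icc_eq_integral_Ioc,
        ← intervalIntegral.integral_of_le hle,
        intervalIntegral.integral_comp_sub_right (fun r => f (s * r)) t, ← hfs.2]
      congr 1 <;> ring
  have hLint : IntegrableOn (fun x => f (D x)) L :=
    (integrableOn_finset_iUnion).2 fun t ht => (hlay t ht).1
  have hLval : ∫ x in L, f (D x) = F.card * ∫ r in -δ..δ, f r := by
    rw [hL, integral_biUnion_finset F (fun t _ => measurableSet_Icc) ?_ fun t ht => (hlay t ht).1,
      Finset.sum_congr rfl fun t ht => (hlay t ht).2, Finset.sum_const, nsmul_eq_mul]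
    intro t ht t' ht' hne
    rw [Function.onFun, Set.disjoint_left]
    intro x hx hx'
    have h3 := hsep t (by simp [Finset.mem_coe.1 ht]) t' (by simp [Finset.mem_coe.1 ht']) hne
    have : |t - t'| ≤ 2 * δ := abs_le.2
      ⟨by linarith [hx.1, hx.2, hx'.1, hx'.2], by linarith [hx.1, hx.2, hx'.1, hx'.2]⟩
    linarith
  have hcp : EqOn (fun x => f (D x)) (fun _ => f δ) Rp := fun x hx => by
    have : D x = δ := hx.2
    simp only [this]
  have hcm : EqOn (fun x => f (D x)) (fun _ => f (-δ)) Rm := fun x hx => by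
    have : D x = -δ := hx.2
    simp only [this]
  have hip : IntegrableOn (fun x => f (D x)) Rp :=
    (integrableOn_const (hfin _ (inter_subset_left.trans sdiff_subset))).congr_fun hcp.symm hRpm
  have him : IntegrableOn (fun x => f (D x)) Rm :=
    (integrableOn_const (hfin _ (inter_subset_left.trans sdiff_subset))).congr_fun hcm.symm hRmm
  have hsplit : Ioc c (c + 2 * l) = L ∪ (Rp ∪ Rm) := by
    rw [← hR, union_sdiff_cancel hLsub]
  have hle : c ≤ c + 2 * l := by linarith
  have hLR : Disjoint L (Rp ∪ Rm) := by rw [← hR]; exact disjoint_sdiff_self_right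
  constructor
  · rw [intervalIntegrable_iff_integrableOn_Ioc_of_le hle, hsplit]
    exact hLint.union (hip.union him)
  · rw [intervalIntegral.integral_of_le hle, hsplit,
      setIntegral_union hLR (hRpm.union hRmm) hLint (hip.union him),
      setIntegral_union hdisj hRmm hip him, hLval, setIntegral_congr_fun hRpm hcp,
      setIntegral_congr_fun hRmm hcm, setIntegral_const, setIntegral_const, smul_eq_mul,
      smul_eq_mul]

/-- The mean-zero condition enters here, making the two plateaus equally large. The other properties
are read off the descriptions near and away from the jumps and carried over by periodicity. -/
theorem isTruncDist_boxAvg (hm : Measurable v) (hv : ∀ x, v x = 1 ∨ v x = -1)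
    (hp : v.Periodic (2 * l)) (hl : 0 < l) (hc : c ∉ jumpSet v)
    (hFJ : ∀ t, t ∈ F ↔ t ∈ jumpSet v ∧ t ∈ Ioo c (c + 2 * l))
    (hδ : 0 < δ) (hsep : ∀ x ∈ insert c (insert (c + 2 * l) F),
      ∀ y ∈ insert c (insert (c + 2 * l) F), x ≠ y → 4 * δ ≤ |x - y|)
    (h0 : ∫ x in -l..l, v x = 0) : ∃ a, IsTruncDist l v F.card δ a (boxAvg v δ) := by
  have hT : (0 : ℝ) < 2 * l := by linarith
  set D := boxAvg v δ with hD
  have hDp : D.Periodic (2 * l) := boxAvg_periodic hp δ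
  have hDc : Continuous D := (boxAvg_lipschitz hm hv δ).continuous
  have hwin : ∀ f : ℝ → ℝ, f.Periodic (2 * l) →
      ∫ x in -l..l, f x = ∫ x in c..c + 2 * l, f x := fun f hf => by
    have := hf.intervalIntegral_add_eq (-l) c
    rwa [show -l + 2 * l = l by ring] at this
  have hsign : ∀ᵐ x, 0 < v x * D x := by
    refine ae_of_periodic (c := c) hT (fun x => by rw [hp x, hDp x]) ?_
    have hF0 : volume (F : Set ℝ) = 0 := F.finite_toSet.measure_zero volume
    filter_upwards [ae_eq_of_locallyEq v 1, ae_eq_of_locallyEq v (-1),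
      measure_eq_zero_iff_ae_notMem.1 hF0] with x h1 h2 hxF hx
    have hloc : ∀ s, (s = 1 ∨ s = -1) → LocallyEq v s x → v x = s := by
      rintro s (rfl | rfl)
      exacts [h1, h2]
    by_cases hfar : ∀ t ∈ F, δ ≤ |x - t|
    · obtain ⟨s, hs, hsl, hxs⟩ := boxAvg_far_from_jumps hm hv hp hl hc hFJ hδ hsep
        (Ico_subset_Icc_self hx) hfar
      rw [hloc s hs hsl, hD, hxs]
      rcases hs with rfl | rfl <;> linarith
    · push Not at hfar
      obtain ⟨t, ht, hxt⟩ := hfar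
      obtain ⟨-, -, s, hs, hl1, hl2, hxs⟩ := boxAvg_near_jump hm hv hFJ hδ hsep ht
      have hxt' := abs_lt.1 hxt
      rw [hD, hxs x hxt.le]
      rcases lt_trichotomy x t with h | h | h
      · rw [hloc (-s) (by rcases hs with rfl | rfl <;> simp)
          (LocallyEq.of_ae_Ioo hl1 ⟨by linarith, h⟩)]
        rcases hs with rfl | rfl <;> linarith
      · exact absurd (h ▸ ht) hxF
      · rw [hloc s hs (LocallyEq.of_ae_Ioo hl2 ⟨h, by linarith⟩)]
        rcases hs with rfl | rfl <;> linarith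
  obtain ⟨a, b, ha, hlaw⟩ := boxAvg_law_window hm hv hp hl hc hFJ hδ hsep
  -- The law is applied to the odd function `r / |r|`: the layers contribute nothing and the
  -- plateaus `a - b`, while `D / |D| = v` almost everywhere has integral zero.
  have hab : a = b := by
    have h1 := (hlaw _ (sign_integrable δ)).2
    rw [integral_of_odd (fun r => by rw [abs_neg, neg_div]), ← hwin _ (fun x => by
      rw [boxAvg_periodic hp δ x])] at h1
    have h2 : ∫ x in -l..l, boxAvg v δ x / |boxAvg v δ x| = ∫ x in -l..l, v x :=
      intervalIntegral.integral_congr_ae (by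
        filter_upwards [hsign] with x hx _
        rcases hv x with h | h
        · rw [h, one_mul] at hx
          rw [h, abs_of_pos hx, div_self hx.ne']
        · rw [h, neg_one_mul, neg_pos] at hx
          rw [h, abs_of_neg hx, div_neg, div_self hx.ne])
    rw [h2, h0, abs_neg, abs_of_pos hδ, neg_div, div_self hδ.ne'] at h1
    linarith
  refine ⟨a, hδ, ha, boxAvg_lipschitz hm hv δ, hDp, abs_boxAvg_le hv hδ, hsign, fun f hf => ?_,
    fun x => ?_⟩
  · obtain ⟨h1, h2⟩ := hlaw f hf
    have hfp : Function.Periodic (fun x => f (D x)) (2 * l) := fun x => by simp only [hDp x]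
    refine ⟨hfp.intervalIntegrable hT.ne' h1 _ _, ?_⟩
    rw [hwin _ hfp, h2, hab]; ring
  · have hmain : ∀ x ∈ Ico c (c + 2 * l), deriv D x ^ 2 = if |D x| < δ then 1 else 0 := by
      intro x hx
      split_ifs with hlt
      · have : ∃ t ∈ F, |x - t| < δ := by
          by_contra! hfar
          obtain ⟨s, hs, -, hxs⟩ := boxAvg_far_from_jumps hm hv hp hl hc hFJ hδ hsep
            (Ico_subset_Icc_self hx) hfar
          rw [hD, hxs] at hlt
          rcases hs with rfl | rfl <;> simp [abs_of_pos hδ] at hlt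
        obtain ⟨t, ht, hxt⟩ := this
        obtain ⟨-, -, s, hs, -, -, hxs⟩ := boxAvg_near_jump hm hv hFJ hδ hsep ht
        have hev : D =ᶠ[𝓝 x] fun y => s * (y - t) := by
          have : ∀ᶠ y in 𝓝 x, |y - t| < δ :=
            (by fun_prop : Continuous fun y : ℝ => |y - t|).continuousAt.eventually_lt
              continuousAt_const hxt
          filter_upwards [this] with y hy using hxs y hy.le
        have hd : deriv (fun y => s * (y - t)) x = s := by
          have := ((hasDerivAt_id x).sub_const t).const_mul s
          rw [mul_one] at this
          exact this.deriv
        rw [hev.deriv_eq, hd]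
        rcases hs with rfl | rfl <;> norm_num
      -- Here `D` attains an extremum, so `deriv D x = 0`. At the corners `t ± δ`, where `D` is not
      -- differentiable, this is the default value.
      · have hxe : |D x| = δ := le_antisymm (abs_boxAvg_le hv hδ x) (not_lt.1 hlt)
        have : deriv D x = 0 := by
          rcases (abs_eq hδ.le).1 hxe with h | h
          · exact IsLocalMax.deriv_eq_zero (Eventually.of_forall fun y => by
              rw [h]; exact (abs_le.1 (abs_boxAvg_le hv hδ y)).2)
          · exact IsLocalMin.deriv_eq_zero (Eventually.of_forall fun y => by
              rw [h]; exact (abs_le.1 (abs_boxAvg_le hv hδ y)).1)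
        rw [this]; norm_num
    have hdp : (deriv D).Periodic (2 * l) := fun x => by
      rw [← deriv_comp_add_const, funext hDp]
    have h1 : D x = D (toIcoMod hT c x) := (hDp.sub_zsmul_eq _).symm
    have h2 : deriv D x = deriv D (toIcoMod hT c x) := (hdp.sub_zsmul_eq _).symm
    rw [h1, h2]
    exact hmain _ (toIcoMod_mem_Ico hT c x)

end Window

/-- A periodic function `v = ±1` of bounded variation with mean zero has finitely many jumps in each
period; their number is detected by test functions. -/
theorem exists_isTruncDist {l : ℝ} (hl : 0 < l) {v : ℝ → ℝ} (hm : Measurable v)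
    (hv : ∀ x, v x = 1 ∨ v x = -1) (hp : v.Periodic (2 * l)) (h0 : ∫ x in -l..l, v x = 0)
    {C : ℝ} (hC : ∀ φ : ℝ → ℝ, ContDiff ℝ ∞ φ → φ.Periodic (2 * l) → (∀ z, |φ z| ≤ 1) →
      ∫ x in -l..l, v x * deriv φ x ≤ C) :
    ∃ (k : ℕ) (δ a : ℝ) (D : ℝ → ℝ), IsTruncDist l v k δ a D ∧
      ∀ η > 0, ∃ φ : ℝ → ℝ, ContDiff ℝ ∞ φ ∧ φ.Periodic (2 * l) ∧ (∀ z, |φ z| ≤ 1) ∧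
        2 * k - η < ∫ x in -l..l, v x * deriv φ x := by
  have hT : (0 : ℝ) < 2 * l := by linarith
  have htest : ∀ (c : ℝ) (F : Finset ℝ), (∀ t ∈ F, t ∈ jumpSet v) →
      (∀ t ∈ F, t ∈ Ioo c (c + 2 * l)) → ∀ η > 0, ∃ φ : ℝ → ℝ, ContDiff ℝ ∞ φ ∧
      φ.Periodic (2 * l) ∧ (∀ z, |φ z| ≤ 1) ∧
        2 * F.card - η < ∫ x in -l..l, v x * deriv φ x := fun c F h1 h2 η hη => by
    obtain ⟨φ, a1, a2, a3, a4⟩ := exists_test_of_finset hm hv hT h1 h2 hη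
    refine ⟨φ, a1, a2, a3, ?_⟩
    have hdp : Function.Periodic (fun x => v x * deriv φ x) (2 * l) := fun x => by
      simp only [hp x]
      rw [← deriv_comp_add_const, funext a2]
    have := hdp.intervalIntegral_add_eq (-l) c
    rw [show -l + 2 * l = l by ring] at this
    rwa [this]
  have hfin : ∀ c : ℝ, (jumpSet v ∩ Ioo c (c + 2 * l)).Finite := fun c => by
    by_contra hinf
    -- Already `m` jumps would give a test integral above `2 * m - 1`, which exceeds `C`.
    obtain ⟨m, hmC⟩ := exists_nat_gt (C + 1)
    obtain ⟨F, hF, hcard⟩ := Set.Infinite.exists_subset_card_eq hinf m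
    obtain ⟨φ, a1, a2, a3, a4⟩ := htest c F (fun t ht => (hF ht).1) (fun t ht => (hF ht).2) 1 one_pos
    have := hC φ a1 a2 a3
    rw [hcard] at a4
    have : (0 : ℝ) ≤ m := Nat.cast_nonneg m
    linarith
  -- The period is cut at a point that is not a jump, so that every jump is interior to the window.
  obtain ⟨c, -, hc⟩ : ∃ c ∈ Ioo (-l) (-l + 2 * l), c ∉ jumpSet v := by
    by_contra! hno
    have : (Ioo (-l) (-l + 2 * l)).Infinite := Ioo_infinite (by linarith)
    exact this ((hfin (-l)).subset fun x hx => ⟨hno x hx, hx⟩)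
  set F := (hfin c).toFinset
  have hFJ : ∀ t, t ∈ F ↔ t ∈ jumpSet v ∧ t ∈ Ioo c (c + 2 * l) := fun t => by
    simp [F]
  obtain ⟨δ, hδ, hsep⟩ := exists_separation (insert c (insert (c + 2 * l) F))
  obtain ⟨a, ha⟩ := isTruncDist_boxAvg hm hv hp hl hc hFJ hδ hsep h0
  exact ⟨F.card, δ, a, _, ha,
    htest c F (fun t ht => ((hFJ t).1 ht).1) (fun t ht => ((hFJ t).1 ht).2)⟩

/-! ### Total variation of two-valued functions of `x` -/

theorem integral_fderiv_ex {l : ℝ} (hl : 0 < l) {φ : ℝ × ℝ → ℝ} (hφ : IsTest l φ) :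
    ∫ p, fderiv ℝ φ p ex ∂(torus l) = 0 := by
  have := (hasWeakDeriv_ex_of_lipschitz hl (LipschitzWith.const (1 : ℝ)) (fun _ => rfl)).2.2 φ hφ
  simpa using this

theorem integral_fderiv_ey {l : ℝ} (hl : 0 < l) {φ : ℝ × ℝ → ℝ} (hφ : IsTest l φ) :
    ∫ p, fderiv ℝ φ p ey ∂(torus l) = 0 := by
  have := integral_mul_fderiv_ey hl (u := fun _ => 1) (integrable_const _) hφ
  simpa using this

theorem integrable_two_valued_torus {v : ℝ → ℝ} (hm : Measurable v)
    (hv : ∀ x, v x = 1 ∨ v x = -1) (l : ℝ) : Integrable (fun p : ℝ × ℝ => v p.1) (torus l) :=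
  integrable_torus_of_bound (C := 1) (hm.comp measurable_fst).aestronglyMeasurable
    (Eventually.of_forall fun p => by rcases hv p.1 with h | h <;> simp [h])

/-- Constants do not see a divergence on the torus, and functions of `x` alone do not see the
`y`-derivative. -/
theorem integral_affine_two_valued {l : ℝ} (hl : 0 < l) {v : ℝ → ℝ} (hm : Measurable v)
    (hv : ∀ x, v x = 1 ∨ v x = -1) {u : ℝ × ℝ → ℝ} {a b : ℝ}
    (hu : u =ᵐ[torus l] fun p => a + b * v p.1) {φ ψ : ℝ × ℝ → ℝ} (hφ : IsTest l φ)
    (hψ : IsTest l ψ) :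
    ∫ p, u p * (fderiv ℝ φ p ex + fderiv ℝ ψ p ey) ∂(torus l)
      = b * ∫ p, v p.1 * fderiv ℝ φ p ex ∂(torus l) := by
  have hvi := integrable_two_valued_torus hm hv l
  have i1 := integrable_mul_continuous hvi (hφ.continuous_fderiv ex)
  have i2 := integrable_mul_continuous hvi (hψ.continuous_fderiv ey)
  have j1 := integrable_mul_continuous (integrable_const a : Integrable _ (torus l))
    (hφ.continuous_fderiv ex)
  have j2 := integrable_mul_continuous (integrable_const a : Integrable _ (torus l))
    (hψ.continuous_fderiv ey)
  have h1 : ∫ p, u p * (fderiv ℝ φ p ex + fderiv ℝ ψ p ey) ∂(torus l)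
      = ∫ p, (a * fderiv ℝ φ p ex + a * fderiv ℝ ψ p ey)
        + (b * (v p.1 * fderiv ℝ φ p ex) + b * (v p.1 * fderiv ℝ ψ p ey)) ∂(torus l) :=
    integral_congr_ae (hu.mono fun p hp => by simp only [hp]; ring)
  have jj : Integrable (fun p => a * fderiv ℝ φ p ex + a * fderiv ℝ ψ p ey) (torus l) := j1.add j2
  have ii : Integrable (fun p => b * (v p.1 * fderiv ℝ φ p ex) + b * (v p.1 * fderiv ℝ ψ p ey))
      (torus l) := (i1.const_mul b).add (i2.const_mul b)
  rw [h1, integral_add jj ii, integral_add j1 j2,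
    integral_add (i1.const_mul b) (i2.const_mul b), integral_const_mul, integral_const_mul,
    integral_const_mul, integral_const_mul, integral_fderiv_ex hl hφ, integral_fderiv_ey hl hψ,
    integral_mul_fderiv_ey hl hvi hψ]
  ring

theorem le_totalVariation {l : ℝ} (hl : 0 < l) {v : ℝ → ℝ} (hm : Measurable v)
    (hv : ∀ x, v x = 1 ∨ v x = -1) {u : ℝ × ℝ → ℝ} {a b : ℝ}
    (hu : u =ᵐ[torus l] fun p => a + b * v p.1) {φ : ℝ → ℝ} (hφ : ContDiff ℝ ∞ φ)
    (hp : φ.Periodic (2 * l)) (hb : ∀ z, |φ z| ≤ 1) :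
    ENNReal.ofReal (2 * l * (b * ∫ x in -l..l, v x * deriv φ x)) ≤ totalVariation l u := by
  have h := integral_affine_two_valued hl hm hv hu (isTest_fst hφ hp) (isTest_zero l)
  simp only [fderiv_comp_fst_ex hφ] at h
  rw [integral_torus_fst hl (fun x => v x * deriv φ x)] at h
  refine le_iSup_of_le (fun p => φ p.1) <| le_iSup_of_le (fun _ => 0) <|
    le_iSup_of_le (isTest_fst hφ hp) <| le_iSup_of_le (isTest_zero l) <|
    le_iSup_of_le (fun p => ?_) ?_
  · have := (sq_le_one_iff_abs_le_one _).2 (hb p.1)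
    simpa using this
  · simp only [fderiv_comp_fst_ex hφ]
    rw [h]
    exact le_of_eq (by ring_nf)

theorem integral_indicator_abs_le {δ η : ℝ} (hη : 0 < η) (hηδ : η < δ) :
    IntervalIntegrable (fun r : ℝ => if |r| ≤ η then (1 : ℝ) else 0) volume (-δ) δ ∧
      ∫ r in -δ..δ, (if |r| ≤ η then (1 : ℝ) else 0) = 2 * η := by
  have e : (fun r : ℝ => if |r| ≤ η then (1 : ℝ) else 0) = (Icc (-η) η).indicator fun _ => 1 := by
    ext r
    simp only [indicator, mem_Icc, abs_le]
  rw [e]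
  constructor
  · have : Integrable ((Icc (-η) η).indicator fun _ => (1 : ℝ)) volume :=
      (integrable_indicator_iff measurableSet_Icc).2 (integrableOn_const (by simp))
    exact this.intervalIntegrable
  · have hsub : Icc (-η) η ⊆ Ioc (-δ) δ := fun r hr =>
      ⟨by linarith [hr.1], by linarith [hr.2]⟩
    rw [intervalIntegral.integral_of_le (by linarith), integral_indicator measurableSet_Icc,
      Measure.restrict_restrict measurableSet_Icc,
      inter_eq_left.2 hsub, setIntegral_const,
      Real.volume_real_Icc_of_le (by linarith), smul_eq_mul]
    ring

/-- The function `v` is approximated by `D` truncated at `±η` and divided by `η`, whose derivative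
is at most `1 / η` and vanishes off `|D| ≤ η`. By the law this set has length `2 * η * k` per
period, so the bound does not depend on `η`, and dominated convergence gives it for `v`. -/
theorem IsTruncDist.abs_integral_le {l : ℝ} (hl : 0 < l) {v : ℝ → ℝ}
    (hv : ∀ x, v x = 1 ∨ v x = -1) {k : ℕ} {δ a : ℝ} {D : ℝ → ℝ} (hD : IsTruncDist l v k δ a D)
    {φ : ℝ × ℝ → ℝ} (hφ : IsTest l φ) (hb : ∀ p, |φ p| ≤ 1) :
    |∫ p, v p.1 * fderiv ℝ φ p ex ∂(torus l)| ≤ 2 * l * (2 * k) := by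
  set Dη : ℝ → ℝ → ℝ := fun η x => max (-η) (min (D x) η) with hDη
  have hDc := hD.lipschitz.continuous
  have habs : ∀ η, 0 < η → ∀ x, |Dη η x| ≤ η := fun η hη x => by
    rw [abs_le]
    exact ⟨le_max_left _ _, max_le (by linarith) (min_le_right _ _)⟩
  have hlip : ∀ η, LipschitzWith 1 (Dη η) := fun η => (hD.lipschitz.min_const η).const_max (-η)
  have hder : ∀ η, 0 < η → ∀ x, |deriv (Dη η) x| ≤ if |D x| ≤ η then 1 else 0 := fun η hη x => by
    split_ifs with h
    · simpa using norm_deriv_le_of_lipschitz (hlip η) (x₀ := x)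
    · rw [not_le, lt_abs] at h
      have : ∃ s, Dη η =ᶠ[𝓝 x] fun _ => s := by
        rcases h with h | h
        · refine ⟨η, ?_⟩
          filter_upwards [hDc.continuousAt.eventually_const_lt h] with y hy
          simp only [hDη]
          rw [min_eq_right hy.le, max_eq_right (by linarith)]
        · refine ⟨-η, ?_⟩
          filter_upwards [hDc.continuousAt.eventually_lt_const (by linarith : D x < -η)] with y hy
          simp only [hDη]
          rw [min_eq_left (by linarith), max_eq_left hy.le]
      obtain ⟨s, hs⟩ := this
      rw [hs.deriv_eq]; simp
  have hstep : ∀ η, 0 < η → η < δ →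
      |∫ p, Dη η p.1 / η * fderiv ℝ φ p ex ∂(torus l)| ≤ 2 * l * (2 * k) := fun η hη hηδ => by
    have h1 := (hasWeakDeriv_ex_of_lipschitz hl (hlip η) (fun x => by
      simp only [hDη, hD.periodic x])).2.2 φ hφ
    have h2 : ∫ p, Dη η p.1 / η * fderiv ℝ φ p ex ∂(torus l)
        = -(1 / η * ∫ p, deriv (Dη η) p.1 * φ p ∂(torus l)) := by
      rw [← mul_neg, ← h1, ← integral_const_mul]
      congr 1; ext p; ring
    obtain ⟨g1, g2⟩ := integral_indicator_abs_le hη hηδ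
    obtain ⟨l1, l2⟩ := hD.law _ g1
    have hnδ : ¬ |δ| ≤ η := by rw [abs_of_pos hD.δ_pos]; linarith
    rw [g2, abs_neg, if_neg hnδ, add_zero, mul_zero, add_zero] at l2
    have hint : Integrable (fun p : ℝ × ℝ => if |D p.1| ≤ η then (1 : ℝ) else 0) (torus l) := by
      refine integrable_torus_of_bound (C := 1) ?_ (Eventually.of_forall fun p => ?_)
      · refine (Measurable.ite ?_ measurable_const measurable_const).aestronglyMeasurable
        exact measurableSet_le (hDc.measurable.comp measurable_fst).norm measurable_const
      · split_ifs <;> simp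
    have h3 : |∫ p, deriv (Dη η) p.1 * φ p ∂(torus l)|
        ≤ ∫ p, (if |D p.1| ≤ η then (1 : ℝ) else 0) ∂(torus l) := by
      rw [← Real.norm_eq_abs]
      refine norm_integral_le_of_norm_le hint (Eventually.of_forall fun p => ?_)
      rw [norm_mul, Real.norm_eq_abs, Real.norm_eq_abs]
      calc |deriv (Dη η) p.1| * |φ p| ≤ |deriv (Dη η) p.1| * 1 :=
            mul_le_mul_of_nonneg_left (hb p) (abs_nonneg _)
        _ ≤ _ := by rw [mul_one]; exact hder η hη p.1
    rw [integral_torus_fst hl (fun x => if |D x| ≤ η then (1 : ℝ) else 0), l2] at h3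
    rw [h2, abs_neg, abs_mul, abs_of_pos (by positivity : 0 < 1 / η)]
    calc 1 / η * |∫ p, deriv (Dη η) p.1 * φ p ∂(torus l)|
        ≤ 1 / η * (2 * l * (k * (2 * η))) := by gcongr
      _ = 2 * l * (2 * k) := by field_simp
  set s : ℕ → ℝ := fun m => δ / ((m : ℝ) + 2) with hs
  have hspos : ∀ m, 0 < s m := fun m => div_pos hD.δ_pos (by positivity)
  have hslt : ∀ m, s m < δ := fun m => div_lt_self hD.δ_pos (by
    have : (0 : ℝ) ≤ m := Nat.cast_nonneg m
    linarith)
  have hs0 : Tendsto s atTop (𝓝 0) :=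
    tendsto_const_nhds.div_atTop (tendsto_atTop_add_const_right _ _ tendsto_natCast_atTop_atTop)
  have hlim : Tendsto (fun m => ∫ p, Dη (s m) p.1 / s m * fderiv ℝ φ p ex ∂(torus l)) atTop
      (𝓝 (∫ p, v p.1 * fderiv ℝ φ p ex ∂(torus l))) := by
    have hcφ := hφ.continuous_fderiv ex
    obtain ⟨C, hC⟩ := exists_bound_torus hcφ l
    refine tendsto_integral_of_dominated_convergence (fun _ => C) (fun m => ?_) (integrable_const C)
      (fun m => ?_) ?_
    · exact ((((hlip (s m)).continuous.comp continuous_fst).div_const _).mul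
        hcφ).aestronglyMeasurable
    · filter_upwards [hC] with p hp
      rw [norm_mul, norm_div, Real.norm_eq_abs, Real.norm_eq_abs, abs_of_pos (hspos m)]
      have : |Dη (s m) p.1| / s m ≤ 1 := (div_le_one (hspos m)).2 (habs _ (hspos m) _)
      calc |Dη (s m) p.1| / s m * ‖fderiv ℝ φ p ex‖ ≤ 1 * ‖fderiv ℝ φ p ex‖ :=
            mul_le_mul_of_nonneg_right this (norm_nonneg _)
        _ ≤ C := by rw [one_mul]; exact hp
    · have hsg := ae_torus_fst (l := l) (ae_restrict_of_ae hD.sign)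
      filter_upwards [hsg] with p hp
      refine tendsto_const_nhds.congr' ?_
      have hne : 0 < |D p.1| := abs_pos.2 fun h => by rw [h, mul_zero] at hp; exact lt_irrefl _ hp
      filter_upwards [hs0.eventually_lt_const hne] with m hm
      congr 1
      have hsm := hspos m
      simp only [hDη]
      rcases hv p.1 with h | h
      · rw [h, one_mul] at hp
        rw [abs_of_pos hp] at hm
        rw [h, min_eq_right hm.le, max_eq_right (by linarith), div_self hsm.ne']
      · rw [h, neg_one_mul, neg_pos] at hp
        rw [abs_of_neg hp] at hm
        rw [h, min_eq_left (by linarith), max_eq_left (by linarith), neg_div, div_self hsm.ne']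
  exact le_of_tendsto hlim.abs (Eventually.of_forall fun m => hstep _ (hspos m) (hslt m))

/-- The perimeter of the phase `{v = -1}` is the total length of the jump lines. -/
theorem IsTruncDist.perimeter_eq {l : ℝ} (hl : 0 < l) {v : ℝ → ℝ} (hm : Measurable v)
    (hv : ∀ x, v x = 1 ∨ v x = -1) {k : ℕ} {δ a : ℝ} {D : ℝ → ℝ} (hD : IsTruncDist l v k δ a D)
    (htest : ∀ η > 0, ∃ φ : ℝ → ℝ, ContDiff ℝ ∞ φ ∧ φ.Periodic (2 * l) ∧ (∀ z, |φ z| ≤ 1) ∧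
        2 * k - η < ∫ x in -l..l, v x * deriv φ x)
    {E : Set (ℝ × ℝ)} (hE : ∀ᵐ p ∂(torus l), p ∈ E ↔ v p.1 = -1) :
    perimeter l E = ENNReal.ofReal (2 * l * k) := by
  -- The factor `-1 / 2` turns the jump of size 2 into one of size 1; its sign is why the lower
  -- bound below tests with `-φ`.
  have hu : (E.indicator fun _ => (1 : ℝ)) =ᵐ[torus l] fun p => 1 / 2 + (-1 / 2) * v p.1 := by
    filter_upwards [hE] with p hp
    rcases hv p.1 with h | h
    · have : p ∉ E := fun h' => by rw [hp, h] at h'; norm_num at h'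
      rw [indicator_of_notMem this, h]; norm_num
    · rw [indicator_of_mem (hp.2 h), h]; norm_num
  refine le_antisymm ?_ ?_
  · refine iSup_le fun φ => iSup_le fun ψ => iSup_le fun hφ => iSup_le fun hψ => iSup_le fun hb => ?_
    refine ENNReal.ofReal_le_ofReal ?_
    rw [integral_affine_two_valued hl hm hv hu hφ hψ]
    have := hD.abs_integral_le hl hv hφ (fun p => by
      rw [← sq_le_one_iff_abs_le_one]; nlinarith [hb p, sq_nonneg (ψ p)])
    have := (abs_le.1 this).1
    linarith
  · have hη : ∀ η : ℝ, 0 < η → ENNReal.ofReal (2 * l * k - l * η) ≤ perimeter l E := fun η hη => by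
      obtain ⟨φ, h1, h2, h3, h4⟩ := htest η hη
      refine le_trans (ENNReal.ofReal_le_ofReal ?_)
        (le_totalVariation hl hm hv hu h1.neg (fun x => by simp only [h2 x])
          (fun z => by rw [abs_neg]; exact h3 z))
      simp only [deriv.fun_neg, mul_neg, intervalIntegral.integral_neg]
      nlinarith
    have hlim : Tendsto (fun η : ℝ => ENNReal.ofReal (2 * l * k - l * η)) (𝓝[>] 0)
        (𝓝 (ENNReal.ofReal (2 * l * k - l * 0))) := by
      refine (ENNReal.continuous_ofReal.tendsto _).comp (Tendsto.mono_left ?_ nhdsWithin_le_nhds)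
      exact (by fun_prop : Continuous fun η : ℝ => 2 * l * k - l * η).tendsto 0
    rw [mul_zero, sub_zero] at hlim
    refine le_of_tendsto hlim ?_
    filter_upwards [self_mem_nhdsWithin] with η h using hη η h

/-! ### The optimal cost `c₀` -/

theorem wellA_pos {σ : ℝ} (hσ : 0 < σ) : 0 < wellA σ := by rw [wellA]; positivity

theorem wellA_lt_one {σ : ℝ} (hσ : 0 < σ) : wellA σ < 1 := by
  rw [wellA]; exact inv_lt_one_of_one_lt₀ (by linarith)

theorem sigma_eq (σ : ℝ) : σ = 1 / wellA σ - 1 := by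
  rw [wellA, one_div, inv_inv]; ring

theorem cos_angle {σ : ℝ} (hσ : 0 < σ) : Real.cos (angle σ) = wellA σ :=
  Real.cos_arccos (by linarith [wellA_pos hσ]) (wellA_lt_one hσ).le

theorem sin_angle (σ : ℝ) : Real.sin (angle σ) = nbar σ := Real.sin_arccos _

theorem angle_pos {σ : ℝ} (hσ : 0 < σ) : 0 < angle σ := Real.arccos_pos.2 (wellA_lt_one hσ)

theorem angle_lt {σ : ℝ} (hσ : 0 < σ) : angle σ < Real.pi / 2 :=
  Real.arccos_lt_pi_div_two.2 (wellA_pos hσ)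

theorem nbar_pos {σ : ℝ} (hσ : 0 < σ) : 0 < nbar σ := by
  rw [← sin_angle]
  exact Real.sin_pos_of_pos_of_lt_pi (angle_pos hσ) (by linarith [angle_lt hσ, Real.pi_pos])

theorem nbar_sq {σ : ℝ} (hσ : 0 < σ) : nbar σ ^ 2 = 1 - wellA σ ^ 2 := by
  rw [nbar, Real.sq_sqrt]
  nlinarith [wellA_pos hσ, wellA_lt_one hσ]

theorem wellA_le_cos {σ θ : ℝ} (hσ : 0 < σ) (h : |θ| ≤ angle σ) : wellA σ ≤ Real.cos θ := by
  rw [← cos_angle hσ, ← Real.cos_abs θ]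
  exact Real.cos_le_cos_of_nonneg_of_le_pi (abs_nonneg _) (by linarith [angle_lt hσ, Real.pi_pos]) h

/-- The point of the great circle through the wells with angle `θ` to the north pole. -/
noncomputable def circlePt (θ : ℝ) : E3 := !₂[Real.sin θ, 0, Real.cos θ]

theorem greatArc_eq (σ t : ℝ) : greatArc σ t = circlePt (2 * angle σ * t - angle σ) := rfl

theorem norm_circlePt (θ : ℝ) : ‖circlePt θ‖ = 1 := by
  rw [EuclideanSpace.norm_eq, Fin.sum_univ_three]
  simp [circlePt]

theorem circlePt_angle {σ : ℝ} (hσ : 0 < σ) : circlePt (angle σ) = nPlus σ := by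
  rw [circlePt, nPlus, sin_angle, cos_angle hσ]

theorem circlePt_neg_angle {σ : ℝ} (hσ : 0 < σ) : circlePt (-angle σ) = nMinus σ := by
  rw [circlePt, nMinus, Real.sin_neg, Real.cos_neg, sin_angle, cos_angle hσ]

theorem potW_circlePt (σ θ : ℝ) :
    potW σ (circlePt θ) = 1 / wellA σ * (Real.cos θ - wellA σ) ^ 2 := by
  simp [potW, circlePt]

theorem sqrt_potW_circlePt {σ θ : ℝ} (hσ : 0 < σ) (h : |θ| ≤ angle σ) :
    Real.sqrt (potW σ (circlePt θ)) = (Real.cos θ - wellA σ) / Real.sqrt (wellA σ) := by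
  rw [potW_circlePt, one_div, inv_mul_eq_div, Real.sqrt_div' _ (wellA_pos hσ).le,
    Real.sqrt_sq (by linarith [wellA_le_cos hσ h])]

theorem hasDerivAt_circlePt (θ : ℝ) :
    HasDerivAt circlePt !₂[Real.cos θ, 0, -Real.sin θ] θ := by
  have e : circlePt = fun θ => Real.sin θ • (!₂[1, 0, 0] : E3) + Real.cos θ • (!₂[0, 0, 1] : E3) := by
    ext θ i; fin_cases i <;> simp [circlePt]
  rw [e]
  refine (((Real.hasDerivAt_sin θ).smul_const (!₂[1, 0, 0] : E3)).fun_add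
    ((Real.hasDerivAt_cos θ).smul_const (!₂[0, 0, 1] : E3))).congr_deriv ?_
  ext i; fin_cases i <;> simp

theorem contDiff_circlePt : ContDiff ℝ ∞ circlePt := by
  have e : circlePt = fun θ => Real.sin θ • (!₂[1, 0, 0] : E3) + Real.cos θ • (!₂[0, 0, 1] : E3) := by
    ext θ i; fin_cases i <;> simp [circlePt]
  rw [e]
  exact (Real.contDiff_sin.smul contDiff_const).add (Real.contDiff_cos.smul contDiff_const)

/-- The primitive of `√W` along the great circle. -/
noncomputable def arcCost (σ θ : ℝ) : ℝ :=
  (Real.sin θ - wellA σ * θ) / Real.sqrt (wellA σ)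

theorem hasDerivAt_arcCost (σ θ : ℝ) :
    HasDerivAt (arcCost σ) ((Real.cos θ - wellA σ) / Real.sqrt (wellA σ)) θ := by
  exact (((Real.hasDerivAt_sin θ).fun_sub ((hasDerivAt_id θ).const_mul (wellA σ))).div_const
    (Real.sqrt (wellA σ))).congr_deriv (by simp)

theorem arcCost_neg (σ θ : ℝ) : arcCost σ (-θ) = -arcCost σ θ := by
  rw [arcCost, arcCost, Real.sin_neg]; ring

theorem integral_cost_greatArc {σ : ℝ} (hσ : 0 < σ) :
    ∫ t in (0 : ℝ)..1, Real.sqrt (potW σ (greatArc σ t)) *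
      ‖derivWithin (greatArc σ) (Icc 0 1) t‖ = 2 * arcCost σ (angle σ) := by
  have hα := angle_pos hσ
  have hlin : ∀ t : ℝ, HasDerivAt (fun t => 2 * angle σ * t - angle σ) (2 * angle σ) t := fun t => by
    simpa using ((hasDerivAt_id t).const_mul (2 * angle σ)).sub_const (angle σ)
  have hd : ∀ t : ℝ, HasDerivAt (fun t => arcCost σ (2 * angle σ * t - angle σ))
      ((Real.cos (2 * angle σ * t - angle σ) - wellA σ) / Real.sqrt (wellA σ) * (2 * angle σ)) t :=
    fun t => (hasDerivAt_arcCost σ _).comp t (hlin t)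
  have hcongr : EqOn (fun t => Real.sqrt (potW σ (greatArc σ t)) *
      ‖derivWithin (greatArc σ) (Icc 0 1) t‖)
      (fun t => (Real.cos (2 * angle σ * t - angle σ) - wellA σ) / Real.sqrt (wellA σ)
        * (2 * angle σ)) (uIcc 0 1) := fun t ht => by
    rw [uIcc_of_le zero_le_one] at ht
    have h1 : HasDerivAt (greatArc σ) ((2 * angle σ) • !₂[Real.cos (2 * angle σ * t - angle σ), 0,
        -Real.sin (2 * angle σ * t - angle σ)]) t :=
      (hasDerivAt_circlePt _).scomp t (hlin t)
    have h2 : ‖(!₂[Real.cos (2 * angle σ * t - angle σ), 0,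
        -Real.sin (2 * angle σ * t - angle σ)] : E3)‖ = 1 := by
      rw [EuclideanSpace.norm_eq, Fin.sum_univ_three]
      simp
    simp only
    rw [h1.hasDerivWithinAt.derivWithin (uniqueDiffOn_Icc zero_lt_one t ht), norm_smul, h2, mul_one,
      Real.norm_of_nonneg (by linarith), greatArc_eq, sqrt_potW_circlePt hσ]
    rw [abs_le]
    constructor <;> nlinarith [ht.1, ht.2]
  rw [intervalIntegral.integral_congr hcongr, intervalIntegral.integral_eq_sub_of_hasDerivAt
    (fun t _ => hd t) (Continuous.intervalIntegrable (by fun_prop) _ _)]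
  rw [show 2 * angle σ * 1 - angle σ = angle σ by ring,
    show 2 * angle σ * 0 - angle σ = -angle σ by ring, arcCost_neg]
  ring

/-- The density of the calibration, as a function of the first component of the director. -/
noncomputable def calib (σ s : ℝ) : ℝ :=
  (1 - wellA σ / max (Real.sqrt (1 - s ^ 2)) (wellA σ)) / Real.sqrt (wellA σ)

theorem continuous_calib {σ : ℝ} (hσ : 0 < σ) : Continuous (calib σ) := by
  have hA := wellA_pos hσ
  refine Continuous.div_const (continuous_const.sub (continuous_const.div ?_ fun s => ?_)) _
  · exact (Real.continuous_sqrt.comp (by fun_prop)).max continuous_const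
  · exact (lt_of_lt_of_le hA (le_max_right _ _)).ne'

theorem calib_nonneg {σ : ℝ} (hσ : 0 < σ) (s : ℝ) : 0 ≤ calib σ s := by
  have hA := wellA_pos hσ
  refine div_nonneg (sub_nonneg.2 ?_) (Real.sqrt_nonneg _)
  rw [div_le_one (lt_of_lt_of_le hA (le_max_right _ _))]
  exact le_max_right _ _

theorem integral_calib {σ : ℝ} (hσ : 0 < σ) :
    ∫ s in -nbar σ..nbar σ, calib σ s = 2 * arcCost σ (angle σ) := by
  have hA := wellA_pos hσ
  have hA1 := wellA_lt_one hσ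
  have hn := nbar_pos hσ
  have hn1 : nbar σ < 1 := by nlinarith [nbar_sq hσ]
  have hd : ∀ s ∈ uIcc (-nbar σ) (nbar σ), HasDerivAt
      (fun s => (s - wellA σ * Real.arcsin s) / Real.sqrt (wellA σ)) (calib σ s) s := fun s hs => by
    rw [uIcc_of_le (by linarith)] at hs
    have h1 := (((hasDerivAt_id s).fun_sub ((Real.hasDerivAt_arcsin (by linarith [hs.1])
      (by linarith [hs.2])).const_mul (wellA σ))).div_const (Real.sqrt (wellA σ)))
    have hle : wellA σ ≤ Real.sqrt (1 - s ^ 2) := by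
      apply Real.le_sqrt_of_sq_le
      nlinarith [nbar_sq hσ, hs.1, hs.2]
    rw [calib, max_eq_left hle]
    exact h1.congr_deriv (by ring)
  rw [intervalIntegral.integral_eq_sub_of_hasDerivAt hd ((continuous_calib hσ).intervalIntegrable _ _),
    Real.arcsin_neg, arcCost, sin_angle]
  have : Real.arcsin (nbar σ) = angle σ := by
    rw [← sin_angle]
    exact Real.arcsin_sin (by linarith [angle_pos hσ, Real.pi_pos]) (angle_lt hσ).le
  rw [this]; ring

/-- The calibration inequality at the point `(a, b, c)` of the sphere for the tangent vector `(p, q,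
r)`. With `ρ = √(1 - a²)`, tangency and Cauchy–Schwarz bound `p` by `ρ` times the length of the
vector. It remains to see that `calib σ a * ρ`, the positive part of `(ρ - A) / √A`, is at most
`√W`: for fixed `a` the potential is least at `b = 0`, `c = ρ`. -/
theorem calib_mul_le {σ : ℝ} (hσ : 0 < σ) {a b c p q r : ℝ} (h1 : a ^ 2 + b ^ 2 + c ^ 2 = 1)
    (h2 : a * p + b * q + c * r = 0) :
    calib σ a * p ≤ Real.sqrt (σ * b ^ 2 + 1 / wellA σ * (c - wellA σ) ^ 2)
      * Real.sqrt (p ^ 2 + q ^ 2 + r ^ 2) := by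
  have hA := wellA_pos hσ
  have hA1 := wellA_lt_one hσ
  set A := wellA σ with hAdef
  set ρ := Real.sqrt (1 - a ^ 2) with hρ
  have hρ0 : 0 ≤ ρ := Real.sqrt_nonneg _
  have hρ2 : ρ ^ 2 = 1 - a ^ 2 := Real.sq_sqrt (by nlinarith [sq_nonneg b, sq_nonneg c])
  have hρ1 : ρ ≤ 1 := by nlinarith [sq_nonneg a]
  have hp : p ≤ ρ * Real.sqrt (p ^ 2 + q ^ 2 + r ^ 2) := by
    have hcs : (b * q + c * r) ^ 2 ≤ (b ^ 2 + c ^ 2) * (q ^ 2 + r ^ 2) := by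
      nlinarith [sq_nonneg (b * r - c * q)]
    have hap : (a * p) ^ 2 = (b * q + c * r) ^ 2 := by
      rw [show a * p = -(b * q + c * r) by linarith]; ring
    rw [hρ, ← Real.sqrt_mul (by rw [← hρ2]; positivity)]
    apply Real.le_sqrt_of_sq_le
    have e : 1 - a ^ 2 = b ^ 2 + c ^ 2 := by linarith
    rw [e]
    nlinarith
  have hW : calib σ a * ρ ≤ Real.sqrt (σ * b ^ 2 + 1 / A * (c - A) ^ 2) := by
    rcases le_total ρ A with h | h
    · rw [calib, ← hAdef, ← hρ, max_eq_right h, div_self hA.ne', sub_self, zero_div, zero_mul]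
      exact Real.sqrt_nonneg _
    · have hρp : 0 < ρ := hA.trans_le h
      have hsA : 0 < Real.sqrt A := Real.sqrt_pos.2 hA
      have e : calib σ a * ρ = (ρ - A) / Real.sqrt A := by
        rw [calib, ← hAdef, ← hρ, max_eq_left h]; field_simp
      rw [e]
      apply Real.le_sqrt_of_sq_le
      rw [div_pow, Real.sq_sqrt hA.le, div_le_iff₀ hA]
      have e2 : (σ * b ^ 2 + 1 / A * (c - A) ^ 2) * A = (1 - A) * b ^ 2 + (c - A) ^ 2 := by
        rw [sigma_eq σ, ← hAdef]; field_simp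
      rw [e2]
      have hbc : b ^ 2 + c ^ 2 = ρ ^ 2 := by linarith
      have hcρ : c ≤ ρ := abs_le_of_sq_le_sq' (by nlinarith [sq_nonneg b]) hρ0 |>.2
      -- As `σ = 1 / A - 1`, the difference `A W - (ρ - A)²` equals `A (2 (ρ - c) - b²)`; it is
      -- nonnegative because `ρ + c ≤ 2`.
      have hkey : b ^ 2 ≤ 2 * (ρ - c) := by
        have : b ^ 2 = (ρ - c) * (ρ + c) := by linarith
        rw [this]
        nlinarith
      nlinarith
  calc calib σ a * p ≤ calib σ a * (ρ * Real.sqrt (p ^ 2 + q ^ 2 + r ^ 2)) :=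
        mul_le_mul_of_nonneg_left hp (calib_nonneg hσ a)
    _ = calib σ a * ρ * Real.sqrt (p ^ 2 + q ^ 2 + r ^ 2) := by ring
    _ ≤ _ := mul_le_mul_of_nonneg_right hW (Real.sqrt_nonneg _)

/-- The calibration inequality is integrated along the curve. Its left side is the derivative of a
primitive of `calib` at `γ₁`, so the integral depends only on the endpoints. -/
theorem le_cost {σ : ℝ} (hσ : 0 < σ) {γ : ℝ → E3} (hγ : ContDiffOn ℝ 1 γ (Icc 0 1))
    (hs : ∀ t ∈ Icc (0 : ℝ) 1, ‖γ t‖ = 1) (h0 : γ 0 = nMinus σ) (h1 : γ 1 = nPlus σ) :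
    2 * arcCost σ (angle σ) ≤ ∫ t in (0 : ℝ)..1, Real.sqrt (potW σ (γ t)) *
      ‖derivWithin γ (Icc 0 1) t‖ := by
  set d := derivWithin γ (Icc 0 1) with hd
  have hdc : ContinuousOn d (Icc 0 1) :=
    hγ.continuousOn_derivWithin (uniqueDiffOn_Icc zero_lt_one) le_rfl
  have hcoord : ∀ i : Fin 3, Continuous fun x : E3 => x i := fun i =>
    (EuclideanSpace.proj (𝕜 := ℝ) i : E3 →L[ℝ] ℝ).continuous
  have hder : ∀ t ∈ Ioo (0 : ℝ) 1, ∀ i, HasDerivAt (fun t => γ t i) (d t i) t := fun t ht i => by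
    have h := ((hγ.differentiableOn (by simp)) t (Ioo_subset_Icc_self ht)).hasDerivWithinAt
    have h := h.hasDerivAt (Icc_mem_nhds ht.1 ht.2)
    exact ((EuclideanSpace.proj (𝕜 := ℝ) i : E3 →L[ℝ] ℝ).hasFDerivAt).comp_hasDerivAt t h
  have hsq : ∀ t ∈ Icc (0 : ℝ) 1, γ t 0 ^ 2 + γ t 1 ^ 2 + γ t 2 ^ 2 = 1 := fun t ht => by
    have h := EuclideanSpace.norm_sq_eq (γ t)
    rw [hs t ht, Fin.sum_univ_three] at h
    simpa using h.symm
  have horth : ∀ t ∈ Ioo (0 : ℝ) 1, γ t 0 * d t 0 + γ t 1 * d t 1 + γ t 2 * d t 2 = 0 :=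
    fun t ht => by
      have h := (((hder t ht 0).pow 2).add ((hder t ht 1).pow 2)).add ((hder t ht 2).pow 2)
      have hc : (((fun t => γ t 0) ^ 2 + (fun t => γ t 1) ^ 2) + (fun t => γ t 2) ^ 2)
          =ᶠ[𝓝 t] fun _ => (1 : ℝ) := by
        filter_upwards [Icc_mem_nhds ht.1 ht.2] with s hs
        exact hsq s hs
      have := h.unique ((hasDerivAt_const t (1 : ℝ)).congr_of_eventuallyEq hc)
      simp only [Nat.cast_ofNat, Nat.add_one_sub_one, pow_one] at this
      linarith
  have hΨ : ∀ s, HasDerivAt (fun s => ∫ z in -nbar σ..s, calib σ z) (calib σ s) s := fun s =>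
    intervalIntegral.integral_hasDerivAt_right ((continuous_calib hσ).intervalIntegrable _ _)
      ((continuous_calib hσ).stronglyMeasurableAtFilter _ _) (continuous_calib hσ).continuousAt
  have hΨc : Continuous fun s => ∫ z in -nbar σ..s, calib σ z :=
    continuous_iff_continuousAt.2 fun s => (hΨ s).continuousAt
  have hγc : ∀ i, ContinuousOn (fun t => γ t i) (Icc 0 1) := fun i =>
    (hcoord i).comp_continuousOn hγ.continuousOn
  have hcont1 : ContinuousOn (fun t => calib σ (γ t 0) * d t 0) (Icc 0 1) :=
    ((continuous_calib hσ).comp_continuousOn (hγc 0)).mul ((hcoord 0).comp_continuousOn hdc)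
  have hcont2 : ContinuousOn (fun t => Real.sqrt (potW σ (γ t)) * ‖d t‖) (Icc 0 1) := by
    refine ContinuousOn.mul (Real.continuous_sqrt.comp_continuousOn ?_) hdc.norm
    exact (continuousOn_const.mul ((hγc 1).pow 2)).add
      (continuousOn_const.mul (((hγc 2).sub continuousOn_const).pow 2))
  have hi1 : IntervalIntegrable (fun t => calib σ (γ t 0) * d t 0) volume 0 1 :=
    ContinuousOn.intervalIntegrable (by rwa [uIcc_of_le zero_le_one])
  have hi2 : IntervalIntegrable (fun t => Real.sqrt (potW σ (γ t)) * ‖d t‖) volume 0 1 :=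
    ContinuousOn.intervalIntegrable (by rwa [uIcc_of_le zero_le_one])
  have hftc := intervalIntegral.integral_eq_sub_of_hasDerivAt_of_le zero_le_one
    (hΨc.comp_continuousOn (hγc 0)) (fun t ht => (hΨ (γ t 0)).comp t (hder t ht 0)) hi1
  have e0 : γ 0 0 = -nbar σ := by rw [h0]; simp [nMinus]
  have e1 : γ 1 0 = nbar σ := by rw [h1]; simp [nPlus]
  simp only [Function.comp_apply] at hftc
  rw [e0, e1, intervalIntegral.integral_same, sub_zero, integral_calib hσ] at hftc
  rw [← hftc]
  refine intervalIntegral.integral_mono_on_of_le_Ioo zero_le_one hi1 hi2 fun t ht => ?_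
  have := calib_mul_le hσ (hsq t (Ioo_subset_Icc_self ht)) (horth t ht)
  rw [EuclideanSpace.norm_eq, Fin.sum_univ_three]
  simpa only [Real.norm_eq_abs, sq_abs, potW] using this

theorem c0_eq {σ : ℝ} (hσ : 0 < σ) : c0 σ = 2 * arcCost σ (angle σ) := by
  refine IsLeast.csInf_eq ⟨⟨greatArc σ, ?_, fun t _ => norm_circlePt _, ?_, ?_,
    (integral_cost_greatArc hσ).symm⟩, ?_⟩
  · have : ContDiff ℝ ∞ (greatArc σ) :=
      contDiff_circlePt.comp ((contDiff_const.mul contDiff_id).sub contDiff_const)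
    exact (this.of_le (by simp)).contDiffOn
  · rw [greatArc_eq, show 2 * angle σ * 0 - angle σ = -angle σ by ring, circlePt_neg_angle hσ]
  · rw [greatArc_eq, show 2 * angle σ * 1 - angle σ = angle σ by ring, circlePt_angle hσ]
  · rintro _ ⟨γ, hγ, hs, h0, h1, rfl⟩
    exact le_cost hσ hγ hs h0 h1

/-! ### The optimal profile -/

/-- `tan (α / 2)`. -/
noncomputable def halfTan (σ : ℝ) : ℝ := Real.tan (angle σ / 2)

theorem halfTan_pos {σ : ℝ} (hσ : 0 < σ) : 0 < halfTan σ :=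
  Real.tan_pos_of_pos_of_lt_pi_div_two (by linarith [angle_pos hσ])
    (by linarith [angle_lt hσ, angle_pos hσ])

theorem arctan_halfTan {σ : ℝ} (hσ : 0 < σ) : Real.arctan (halfTan σ) = angle σ / 2 :=
  Real.arctan_tan (by linarith [angle_pos hσ, Real.pi_pos]) (by linarith [angle_pos hσ, angle_lt hσ])

theorem cos_two_mul_arctan (t : ℝ) :
    Real.cos (2 * Real.arctan t) = (1 - t ^ 2) / (1 + t ^ 2) := by
  rw [Real.cos_two_mul, Real.cos_sq_arctan]
  have : 1 + t ^ 2 ≠ 0 := by positivity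
  field_simp
  ring

theorem halfTan_sq {σ : ℝ} (hσ : 0 < σ) :
    (1 + wellA σ) * halfTan σ ^ 2 = 1 - wellA σ := by
  have h := cos_two_mul_arctan (halfTan σ)
  rw [arctan_halfTan hσ, mul_div_cancel₀ _ two_ne_zero, cos_angle hσ] at h
  have : 1 + halfTan σ ^ 2 ≠ 0 := by positivity
  rw [eq_div_iff this] at h
  linarith

/-- The inverse width of the optimal profile. -/
noncomputable def rate (σ : ℝ) : ℝ := (1 - wellA σ) / (2 * halfTan σ * Real.sqrt (wellA σ))

theorem rate_pos {σ : ℝ} (hσ : 0 < σ) : 0 < rate σ := by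
  have := halfTan_pos hσ
  have := Real.sqrt_pos.2 (wellA_pos hσ)
  have := wellA_lt_one hσ
  exact div_pos (by linarith) (by positivity)

/-- The optimal transition between the wells along the great arc. -/
noncomputable def profile (σ ε r : ℝ) : ℝ :=
  2 * Real.arctan (halfTan σ * Real.tanh (rate σ * r / ε))

theorem one_sub_tanh_sq (x : ℝ) : 1 - Real.tanh x ^ 2 = 1 / Real.cosh x ^ 2 := by
  have h := Real.cosh_pos x
  rw [Real.tanh_eq_sinh_div_cosh, div_pow, Real.sinh_sq]
  field_simp
  ring

/-- The half-angle formula with `tan (θ / 2) = halfTan σ * tanh`; the relation `halfTan_sq` makes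
the numerator proportional to `1 - tanh²`. -/
theorem cos_profile_sub {σ : ℝ} (hσ : 0 < σ) (ε r : ℝ) :
    Real.cos (profile σ ε r) - wellA σ = (1 - wellA σ) * (1 - Real.tanh (rate σ * r / ε) ^ 2) /
      (1 + (halfTan σ * Real.tanh (rate σ * r / ε)) ^ 2) := by
  rw [profile, cos_two_mul_arctan]
  set T := Real.tanh (rate σ * r / ε)
  have : 1 + (halfTan σ * T) ^ 2 ≠ 0 := by positivity
  rw [eq_div_iff this, sub_mul, div_mul_cancel₀ _ this]
  have := halfTan_sq hσ
  linear_combination (-T ^ 2) * this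

theorem hasDerivAt_tanh (x : ℝ) : HasDerivAt Real.tanh (1 - Real.tanh x ^ 2) x := by
  have h := (Real.hasDerivAt_sinh x).fun_div (Real.hasDerivAt_cosh x) (Real.cosh_pos x).ne'
  have e : Real.tanh = fun x => Real.sinh x / Real.cosh x := by
    ext x; exact Real.tanh_eq_sinh_div_cosh x
  have hc := (Real.cosh_pos x).ne'
  rw [e]
  refine h.congr_deriv ?_
  field_simp

/-- The equation `ε θ' = √W` of optimal transitions, where the gradient and potential energies
agree. The constant `rate σ` is fixed by it. -/
theorem hasDerivAt_profile {σ ε : ℝ} (hσ : 0 < σ) (r : ℝ) :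
    HasDerivAt (profile σ ε) ((Real.cos (profile σ ε r) - wellA σ) / (Real.sqrt (wellA σ) * ε))
      r := by
  have hlin : HasDerivAt (fun r => rate σ * r / ε) (rate σ / ε) r := by
    simpa using ((hasDerivAt_id r).const_mul (rate σ)).div_const ε
  have h := ((((hasDerivAt_tanh _).comp r hlin).const_mul (halfTan σ)).arctan).const_mul 2
  refine h.congr_deriv ?_
  rw [cos_profile_sub hσ]
  simp only [Function.comp_apply]
  have h1 : 1 + (halfTan σ * Real.tanh (rate σ * r / ε)) ^ 2 ≠ 0 := by positivity
  have h2 := (halfTan_pos hσ).ne'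
  have h3 := (Real.sqrt_pos.2 (wellA_pos hσ)).ne'
  -- For `ε = 0` division by zero makes the profile constant and both derivatives zero.
  rcases eq_or_ne ε 0 with rfl | hε
  · simp
  have e : rate σ * (2 * halfTan σ * Real.sqrt (wellA σ)) = 1 - wellA σ := by
    rw [rate]; exact div_mul_cancel₀ _ (by positivity)
  rw [← e]
  field_simp

theorem profile_neg (σ ε r : ℝ) : profile σ ε (-r) = -profile σ ε r := by
  rw [profile, profile, mul_neg, neg_div, Real.tanh_neg, mul_neg, Real.arctan_neg, mul_neg]

theorem abs_profile_le {σ : ℝ} (hσ : 0 < σ) (ε r : ℝ) : |profile σ ε r| ≤ angle σ := by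
  have ht := halfTan_pos hσ
  have hle : ∀ r, profile σ ε r ≤ angle σ := fun r => by
    have : Real.arctan (halfTan σ * Real.tanh (rate σ * r / ε)) ≤ Real.arctan (halfTan σ) :=
      Real.arctan_mono (by nlinarith [Real.tanh_lt_one (rate σ * r / ε)])
    rw [arctan_halfTan hσ] at this
    rw [profile]; linarith
  rw [abs_le]
  exact ⟨by have := hle (-r); rw [profile_neg] at this; linarith, hle r⟩

theorem cos_profile_sub_mem {σ ε r : ℝ} (hσ : 0 < σ) :
    0 ≤ Real.cos (profile σ ε r) - wellA σ ∧ Real.cos (profile σ ε r) - wellA σ ≤ 1 :=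
  ⟨by linarith [wellA_le_cos hσ (abs_profile_le hσ ε r)],
    by linarith [Real.cos_le_one (profile σ ε r), wellA_pos hσ]⟩

/-- The true decay is exponential, but `cosh x ≥ sinh x ≥ x` suffices: after squaring and division
by `ε` the potential energy is still of order `ε³`. -/
theorem cos_profile_sub_le {σ ε r : ℝ} (hσ : 0 < σ) (hε : 0 < ε) (hr : 0 < r) :
    Real.cos (profile σ ε r) - wellA σ ≤ (ε / (rate σ * r)) ^ 2 := by
  have hk := rate_pos hσ
  have hx : 0 < rate σ * r / ε := by positivity
  have hA := wellA_pos hσ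
  have hA1 := wellA_lt_one hσ
  rw [cos_profile_sub hσ, one_sub_tanh_sq]
  set x := rate σ * r / ε with hxd
  have hsinh : x ^ 2 ≤ Real.cosh x ^ 2 := by
    have : x ≤ Real.sinh x := Real.self_le_sinh_iff.2 hx.le
    rw [Real.cosh_sq]
    nlinarith
  have h1 : 1 / Real.cosh x ^ 2 ≤ 1 / x ^ 2 := one_div_le_one_div_of_le (by positivity) hsinh
  have h0 : 0 ≤ 1 / Real.cosh x ^ 2 := by positivity
  have e : (ε / (rate σ * r)) ^ 2 = 1 / x ^ 2 := by rw [hxd]; field_simp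
  rw [e, div_le_iff₀ (by positivity)]
  have h2 : (1 - wellA σ) * (1 / Real.cosh x ^ 2) ≤ 1 / x ^ 2 := by nlinarith
  have h3 : 0 ≤ 1 / x ^ 2 := by positivity
  nlinarith [sq_nonneg (halfTan σ * Real.tanh x)]

theorem tendsto_profile {σ r : ℝ} (hσ : 0 < σ) (hr : 0 < r) {ε : ℕ → ℝ} (hε : ∀ j, 0 < ε j)
    (hε0 : Tendsto ε atTop (𝓝 0)) : Tendsto (fun j => profile σ (ε j) r) atTop (𝓝 (angle σ)) := by
  have hk := rate_pos hσ
  have h1 : Tendsto (fun j => Real.cos (profile σ (ε j) r)) atTop (𝓝 (wellA σ)) := by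
    have hu : Tendsto (fun j => wellA σ + (ε j / (rate σ * r)) ^ 2) atTop (𝓝 (wellA σ)) := by
      have := ((hε0.div_const (rate σ * r)).pow 2).const_add (wellA σ)
      simpa using this
    refine tendsto_of_tendsto_of_tendsto_of_le_of_le tendsto_const_nhds hu (fun j => ?_) fun j => ?_
    · exact wellA_le_cos hσ (abs_profile_le hσ _ _)
    · have := cos_profile_sub_le hσ (hε j) hr
      dsimp only
      linarith
  have h2 := (Real.continuous_arccos.tendsto _).comp h1
  refine h2.congr fun j => ?_
  have h0 : 0 ≤ profile σ (ε j) r := by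
    have := hε j
    have hx : 0 ≤ rate σ * r / ε j := by positivity
    have hT : 0 ≤ Real.tanh (rate σ * r / ε j) := by
      rw [Real.tanh_eq_sinh_div_cosh]
      exact div_nonneg (Real.sinh_nonneg_iff.2 hx) (Real.cosh_pos _).le
    exact mul_nonneg two_pos.le (Real.arctan_nonneg.2 (mul_nonneg (halfTan_pos hσ).le hT))
  exact Real.arccos_cos h0 ((le_abs_self _).trans
    ((abs_profile_le hσ _ _).trans (by linarith [angle_lt hσ, Real.pi_pos])))

/-- The potential energy density of the profile. -/
noncomputable def profileEnergy (σ ε r : ℝ) : ℝ :=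
  1 / ε * (1 / wellA σ * (Real.cos (profile σ ε r) - wellA σ) ^ 2)

theorem continuous_profile {σ : ℝ} (hσ : 0 < σ) (ε : ℝ) : Continuous (profile σ ε) :=
  continuous_iff_continuousAt.2 fun r => (hasDerivAt_profile hσ r).continuousAt

theorem continuous_profileEnergy {σ : ℝ} (hσ : 0 < σ) (ε : ℝ) :
    Continuous (profileEnergy σ ε) := by
  have := continuous_profile hσ ε
  unfold profileEnergy
  fun_prop

theorem profileEnergy_nonneg {σ ε : ℝ} (hσ : 0 < σ) (hε : 0 < ε) (r : ℝ) :
    0 ≤ profileEnergy σ ε r := by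
  have := wellA_pos hσ
  rw [profileEnergy]; positivity

theorem profileEnergy_neg (σ ε r : ℝ) : profileEnergy σ ε (-r) = profileEnergy σ ε r := by
  rw [profileEnergy, profile_neg, Real.cos_neg, profileEnergy]

/-- Equipartition of energy. -/
theorem mul_deriv_profile_sq {σ ε : ℝ} (hσ : 0 < σ) (hε : 0 < ε) (r : ℝ) :
    ε * deriv (profile σ ε) r ^ 2 = profileEnergy σ ε r := by
  have hA := wellA_pos hσ
  rw [(hasDerivAt_profile hσ r).deriv, profileEnergy, div_pow, mul_pow, Real.sq_sqrt hA.le]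
  field_simp

/-- By the profile equation, the density is the derivative of `arcCost σ ∘ profile σ ε`, and this
function is odd. -/
theorem integral_profileEnergy {σ ε : ℝ} (hσ : 0 < σ) (hε : 0 < ε) (δ : ℝ) :
    ∫ r in -δ..δ, profileEnergy σ ε r = 2 * arcCost σ (profile σ ε δ) := by
  have hA := wellA_pos hσ
  have hd : ∀ r ∈ uIcc (-δ) δ, HasDerivAt (fun r => arcCost σ (profile σ ε r))
      (profileEnergy σ ε r) r := fun r _ => by
    refine ((hasDerivAt_arcCost σ _).comp r (hasDerivAt_profile (ε := ε) hσ r)).congr_deriv ?_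
    rw [profileEnergy, div_mul_div_comm, ← mul_assoc (Real.sqrt _), Real.mul_self_sqrt hA.le]
    field_simp
  rw [intervalIntegral.integral_eq_sub_of_hasDerivAt hd
    ((continuous_profileEnergy hσ ε).intervalIntegrable _ _), profile_neg, arcCost_neg]
  ring

theorem tendsto_profileEnergy {σ r : ℝ} (hσ : 0 < σ) (hr : 0 < r) {ε : ℕ → ℝ}
    (hε : ∀ j, 0 < ε j) (hε0 : Tendsto ε atTop (𝓝 0)) :
    Tendsto (fun j => profileEnergy σ (ε j) r) atTop (𝓝 0) := by
  have hk := rate_pos hσ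
  have hA := wellA_pos hσ
  have hu : Tendsto (fun j => 1 / wellA σ * (ε j ^ 3 / (rate σ * r) ^ 4)) atTop (𝓝 0) := by
    have := ((hε0.pow 3).div_const ((rate σ * r) ^ 4)).const_mul (1 / wellA σ)
    simpa using this
  refine squeeze_zero (fun j => profileEnergy_nonneg hσ (hε j) r) (fun j => ?_) hu
  have h1 := cos_profile_sub_le hσ (hε j) hr
  have h0 := (cos_profile_sub_mem (ε := ε j) (r := r) hσ).1
  have hj := hε j
  have h2 := pow_le_pow_left₀ h0 h1 2
  calc profileEnergy σ (ε j) r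
      ≤ 1 / ε j * (1 / wellA σ * ((ε j / (rate σ * r)) ^ 2) ^ 2) := by
        rw [profileEnergy]; gcongr
    _ = _ := by field_simp

theorem exists_lipschitzWith_profile {σ ε : ℝ} (hσ : 0 < σ) (hε : 0 < ε) :
    ∃ K : NNReal, LipschitzWith K (profile σ ε) := by
  have hA := Real.sqrt_pos.2 (wellA_pos hσ)
  refine ⟨Real.toNNReal (1 / (Real.sqrt (wellA σ) * ε)), lipschitzWith_of_nnnorm_deriv_le
    (fun r => (hasDerivAt_profile hσ r).differentiableAt) fun r => ?_⟩
  rw [← NNReal.coe_le_coe, coe_nnnorm, (hasDerivAt_profile hσ r).deriv, Real.norm_eq_abs]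
  obtain ⟨h0, h1⟩ := cos_profile_sub_mem (ε := ε) (r := r) hσ
  rw [abs_of_nonneg (by positivity)]
  rw [Real.coe_toNNReal _ (by positivity)]
  gcongr

/-! ### The recovery sequence -/

theorem aestronglyMeasurable_of_fst {l : ℝ} (hl : 0 < l) {f : ℝ → ℝ}
    (h : AEStronglyMeasurable (fun p : ℝ × ℝ => f p.1) (torus l)) :
    AEStronglyMeasurable f (volume.restrict (Ico (-l) l)) := by
  rw [torus_eq_prod] at h
  refine AEStronglyMeasurable.of_comp_fst h fun h0 => ?_
  have := congrArg (fun μ => μ univ) h0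
  simp at this
  linarith

theorem primitive_lipschitz {f : ℝ → ℝ} {M : NNReal} (hf : ∀ a b, IntervalIntegrable f volume a b)
    (hM : ∀ x, |f x| ≤ M) (C : ℝ) : LipschitzWith M (fun x => C - ∫ t in (0 : ℝ)..x, f t) := by
  refine LipschitzWith.of_dist_le_mul fun x y => ?_
  rw [Real.dist_eq, Real.dist_eq,
    show (C - ∫ t in (0 : ℝ)..x, f t) - (C - ∫ t in (0 : ℝ)..y, f t)
      = (∫ t in (0 : ℝ)..y, f t) - ∫ t in (0 : ℝ)..x, f t by ring,
    intervalIntegral.integral_interval_sub_left (hf _ _) (hf _ _), abs_sub_comm]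
  have := intervalIntegral.norm_integral_le_of_norm_le_const (a := x) (b := y) (f := f) (C := M)
    fun t _ => hM t
  simpa using this

theorem primitive_periodic {f : ℝ → ℝ} {l : ℝ} (hf : ∀ a b, IntervalIntegrable f volume a b)
    (hp : f.Periodic (2 * l)) (h0 : ∫ x in -l..l, f x = 0) (C : ℝ) :
    Function.Periodic (fun x => C - ∫ t in (0 : ℝ)..x, f t) (2 * l) := fun x => by
  have h1 := hp.intervalIntegral_add_eq x (-l)
  rw [show -l + 2 * l = l by ring, h0] at h1
  have h2 := intervalIntegral.integral_add_adjacent_intervals (hf 0 x) (hf x (x + 2 * l))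
  simp only
  linarith

/-- The director of the recovery sequence. -/
noncomputable def recDir (σ ε : ℝ) (D : ℝ → ℝ) (x : ℝ) : E3 := circlePt (profile σ ε (D x))

theorem recDir_zero (σ ε : ℝ) (D : ℝ → ℝ) (x : ℝ) :
    recDir σ ε D x 0 = Real.sin (profile σ ε (D x)) := rfl

theorem recDir_one (σ ε : ℝ) (D : ℝ → ℝ) (x : ℝ) : recDir σ ε D x 1 = 0 := rfl

theorem recDir_two (σ ε : ℝ) (D : ℝ → ℝ) (x : ℝ) :
    recDir σ ε D x 2 = Real.cos (profile σ ε (D x)) := rfl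

/-- The layer displacement of the recovery sequence. -/
noncomputable def recDisp (σ ε : ℝ) (D : ℝ → ℝ) (C x : ℝ) : ℝ :=
  C - ∫ t in (0 : ℝ)..x, recDir σ ε D t 0

section Recovery

variable {l σ ε : ℝ} {v D : ℝ → ℝ} {k : ℕ} {δ a : ℝ}

theorem recDir_lipschitz (hσ : 0 < σ) (hε : 0 < ε) (hD : IsTruncDist l v k δ a D) (i : Fin 3) :
    ∃ K, LipschitzWith K (fun x => recDir σ ε D x i) := by
  obtain ⟨K, hK⟩ := exists_lipschitzWith_profile hσ hε
  fin_cases i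
  · exact ⟨_, Real.lipschitzWith_sin.comp (hK.comp hD.lipschitz)⟩
  · exact ⟨_, LipschitzWith.const (0 : ℝ)⟩
  · exact ⟨_, Real.lipschitzWith_cos.comp (hK.comp hD.lipschitz)⟩

theorem recDir_periodic (hD : IsTruncDist l v k δ a D) (i : Fin 3) :
    Function.Periodic (fun x => recDir σ ε D x i) (2 * l) := fun x => by
  simp only [recDir, hD.periodic x]

theorem continuous_recDir_zero (hσ : 0 < σ) (hD : IsTruncDist l v k δ a D) :
    Continuous (fun x => recDir σ ε D x 0) :=
  Real.continuous_sin.comp ((continuous_profile hσ ε).comp hD.lipschitz.continuous)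

/-- An odd function of `D` integrates to zero: the layers are symmetric and the plateaus have equal
measure. Hence the displacement is periodic. -/
theorem integral_recDir_zero (hσ : 0 < σ) (hD : IsTruncDist l v k δ a D) :
    ∫ x in -l..l, recDir σ ε D x 0 = 0 := by
  have hc : Continuous fun r => Real.sin (profile σ ε r) :=
    Real.continuous_sin.comp (continuous_profile hσ ε)
  have := (hD.law _ (hc.intervalIntegrable _ _)).2
  simp only [recDir_zero]
  rw [this, integral_of_odd (fun r => by rw [profile_neg, Real.sin_neg]), profile_neg, Real.sin_neg]
  ring

theorem recDisp_lipschitz (hσ : 0 < σ) (hD : IsTruncDist l v k δ a D) (C : ℝ) :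
    LipschitzWith 1 (recDisp σ ε D C) :=
  primitive_lipschitz (fun _ _ => (continuous_recDir_zero hσ hD).intervalIntegrable _ _)
    (fun x => by rw [recDir_zero]; exact Real.abs_sin_le_one _) C

theorem recDisp_periodic (hσ : 0 < σ) (hD : IsTruncDist l v k δ a D) (C : ℝ) :
    (recDisp σ ε D C).Periodic (2 * l) :=
  primitive_periodic (fun _ _ => (continuous_recDir_zero hσ hD).intervalIntegrable _ _)
    (recDir_periodic hD 0) (integral_recDir_zero hσ hD) C

theorem deriv_recDisp (hσ : 0 < σ) (hD : IsTruncDist l v k δ a D) (C x : ℝ) :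
    deriv (recDisp σ ε D C) x = -recDir σ ε D x 0 := by
  have hc := continuous_recDir_zero (ε := ε) hσ hD
  exact ((intervalIntegral.integral_hasDerivAt_right (hc.intervalIntegrable _ _)
    (hc.stronglyMeasurableAtFilter _ _) hc.continuousAt).const_sub C).deriv

theorem recovery_mem_setY (hl : 0 < l) (hσ : 0 < σ) (hε : 0 < ε) (hD : IsTruncDist l v k δ a D)
    (C : ℝ) : ((fun p : ℝ × ℝ => recDir σ ε D p.1), fun p : ℝ × ℝ => recDisp σ ε D C p.1)
      ∈ setY l := by
  refine ⟨fun i => ?_, Eventually.of_forall fun p => norm_circlePt _, ?_⟩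
  · obtain ⟨K, hK⟩ := recDir_lipschitz hσ hε hD i
    exact memW12_of_lipschitz hl hK (recDir_periodic hD i)
  · exact memW12_of_lipschitz hl (recDisp_lipschitz hσ hD C) (recDisp_periodic hσ hD C)

theorem sum_deriv_recDir_sq (hσ : 0 < σ) {x : ℝ} (hx : DifferentiableAt ℝ D x) :
    ∑ i : Fin 3, deriv (fun x => recDir σ ε D x i) x ^ 2
      = deriv (profile σ ε) (D x) ^ 2 * deriv D x ^ 2 := by
  have hΘ : HasDerivAt (fun x => profile σ ε (D x)) (deriv (profile σ ε) (D x) * deriv D x) x :=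
    (hasDerivAt_profile (ε := ε) hσ (D x)).differentiableAt.hasDerivAt.comp x hx.hasDerivAt
  rw [Fin.sum_univ_three]
  simp only [recDir_zero, recDir_one, recDir_two]
  rw [hΘ.sin.deriv, hΘ.cos.deriv, deriv_const]
  linear_combination (deriv (profile σ ε) (D x) ^ 2 * deriv D x ^ 2) *
    Real.sin_sq_add_cos_sq (profile σ ε (D x))

/-- The density is a function of `D` alone, so the law of `D` evaluates the energy exactly. -/
theorem energyG_recovery (hl : 0 < l) (hσ : 0 < σ) (hε : 0 < ε) (hD : IsTruncDist l v k δ a D)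
    (C : ℝ) :
    energyG l σ ε (fun p => recDir σ ε D p.1) (fun p => recDisp σ ε D C p.1)
      = ENNReal.ofReal (2 * l * (k * (4 * arcCost σ (profile σ ε δ))
          + a * (2 * profileEnergy σ ε δ))) := by
  -- In the layers gradient and potential contribute equally; on the plateaus the gradient vanishes
  -- and only the potential remains.
  set f : ℝ → ℝ := fun r => (if |r| < δ then 2 else 1) * profileEnergy σ ε r with hf
  have hw := continuous_profileEnergy hσ ε
  have hDc := hD.lipschitz.continuous
  have hex : ∀ i, weakDeriv l ex (fun p => recDir σ ε D p.1 i)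
      =ᵐ[torus l] fun p => deriv (fun x => recDir σ ε D x i) p.1 := fun i => by
    obtain ⟨K, hK⟩ := recDir_lipschitz (ε := ε) hσ hε hD i
    exact (hasWeakDeriv_ex_of_lipschitz hl hK (recDir_periodic hD i)).weakDeriv_ae_eq hl
  have hey : ∀ i, weakDeriv l ey (fun p => recDir σ ε D p.1 i) =ᵐ[torus l] 0 := fun i => by
    obtain ⟨K, hK⟩ := recDir_lipschitz (ε := ε) hσ hε hD i
    exact (hasWeakDeriv_ey_of_fst (u := fun x => recDir σ ε D x i) hl
      (hasWeakDeriv_ex_of_lipschitz hl hK (recDir_periodic hD i)).1).weakDeriv_ae_eq hl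
  have hh := hasWeakDeriv_ex_of_lipschitz hl (recDisp_lipschitz (ε := ε) hσ hD C)
    (recDisp_periodic hσ hD C)
  have hhx := hh.weakDeriv_ae_eq hl
  have hhy := (hasWeakDeriv_ey_of_fst hl hh.1).weakDeriv_ae_eq hl
  have hdiff := ae_torus_fst (l := l) (ae_restrict_of_ae hD.lipschitz.ae_differentiableAt_real)
  have hfD : Integrable (fun p : ℝ × ℝ => f (D p.1)) (torus l) := by
    obtain ⟨B, hB⟩ := exists_bound_torus
      (hw.comp (hDc.comp continuous_fst) : Continuous fun p : ℝ × ℝ => profileEnergy σ ε (D p.1)) l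
    refine integrable_torus_of_bound (C := 2 * B) ?_ ?_
    · refine (Measurable.mul (Measurable.ite ?_ measurable_const measurable_const)
        (hw.comp (hDc.comp continuous_fst)).measurable).aestronglyMeasurable
      exact measurableSet_lt (hDc.measurable.comp measurable_fst).norm measurable_const
    · filter_upwards [hB] with p hp
      simp only [hf]
      rw [norm_mul]
      have : ‖(if |D p.1| < δ then (2 : ℝ) else 1)‖ ≤ 2 := by split_ifs <;> norm_num
      exact mul_le_mul this hp (norm_nonneg _) (by norm_num)
  rw [energyG, if_pos (recovery_mem_setY hl hσ hε hD C), energyF]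
  have hdens : ∀ᵐ p ∂(torus l), ENNReal.ofReal
      (ε * (∑ i : Fin 3, (weakDeriv l ex (fun q => recDir σ ε D q.1 i) p ^ 2
          + weakDeriv l ey (fun q => recDir σ ε D q.1 i) p ^ 2))
      + 1 / ε * potW σ (recDir σ ε D p.1)
      + 1 / ε * (weakDeriv l ex (fun p => recDisp σ ε D C p.1) p + recDir σ ε D p.1 0) ^ 2
      + 1 / ε * (weakDeriv l ey (fun p => recDisp σ ε D C p.1) p + recDir σ ε D p.1 1) ^ 2)
      = ENNReal.ofReal (f (D p.1)) := by
    filter_upwards [ae_all_iff.2 hex, ae_all_iff.2 hey, hhx, hhy, hdiff] with p h1 h2 h3 h4 h5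
    simp only [h1, h2, h3, h4, Pi.zero_apply]
    rw [deriv_recDisp hσ hD, recDir_one]
    congr 1
    have e := sum_deriv_recDir_sq (ε := ε) hσ h5
    have e2 := mul_deriv_profile_sq hσ hε (D p.1)
    have e3 : 1 / ε * potW σ (recDir σ ε D p.1) = profileEnergy σ ε (D p.1) := by
      rw [recDir, potW_circlePt, profileEnergy]
    simp only [ne_eq, OfNat.ofNat_ne_zero, not_false_eq_true, zero_pow, add_zero]
    rw [e, e3, hD.deriv_sq, hf, ← mul_assoc, e2]
    simp only
    split_ifs <;> ring
  rw [lintegral_congr_ae hdens, ← ofReal_integral_eq_lintegral_ofReal hfD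
    (Eventually.of_forall fun p => mul_nonneg (by split_ifs <;> norm_num)
      (profileEnergy_nonneg hσ hε _)), integral_torus_fst hl (fun x => f (D x))]
  have hcongr : ∀ᵐ r, r ∈ uIoc (-δ) δ → f r = 2 * profileEnergy σ ε r := by
    filter_upwards [measure_eq_zero_iff_ae_notMem.1 (measure_singleton δ)] with r hr hr'
    rw [uIoc_of_le (by linarith [hD.δ_pos])] at hr'
    simp only [hf]
    rw [if_pos (abs_lt.2 ⟨hr'.1, lt_of_le_of_ne hr'.2 hr⟩)]
  have hint : IntervalIntegrable f volume (-δ) δ := by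
    refine (((continuous_const.mul hw).intervalIntegrable _ _ :
      IntervalIntegrable (fun r => 2 * profileEnergy σ ε r) volume (-δ) δ)).congr_ae ?_
    rw [EventuallyEq, ae_restrict_iff' measurableSet_uIoc]
    filter_upwards [hcongr] with r hr hr' using (hr hr').symm
  rw [(hD.law f hint).2, intervalIntegral.integral_congr_ae hcongr,
    intervalIntegral.integral_const_mul, integral_profileEnergy hσ hε]
  have h1 : f δ = profileEnergy σ ε δ := by
    simp only [hf, abs_of_pos hD.δ_pos, lt_irrefl, if_false, one_mul]
  have h2 : f (-δ) = profileEnergy σ ε δ := by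
    simp only [hf, abs_neg, abs_of_pos hD.δ_pos, lt_irrefl, if_false, one_mul, profileEnergy_neg]
  rw [h1, h2]
  congr 1; ring

theorem tendsto_energyG_recovery (hl : 0 < l) (hσ : 0 < σ) {e : ℕ → ℝ} (he : ∀ j, 0 < e j)
    (he0 : Tendsto e atTop (𝓝 0)) (hD : IsTruncDist l v k δ a D) (C : ℝ) :
    Tendsto (fun j => energyG l σ (e j) (fun p => recDir σ (e j) D p.1)
      (fun p => recDisp σ (e j) D C p.1)) atTop
      (𝓝 (ENNReal.ofReal (2 * c0 σ) * ENNReal.ofReal (2 * l * k))) := by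
  simp only [fun j => energyG_recovery hl hσ (he j) hD C]
  rw [← ENNReal.ofReal_mul' (by positivity)]
  refine (ENNReal.continuous_ofReal.tendsto _).comp ?_
  have h1 : Tendsto (fun j => arcCost σ (profile σ (e j) δ)) atTop (𝓝 (arcCost σ (angle σ))) :=
    ((hasDerivAt_arcCost σ _).continuousAt.tendsto).comp (tendsto_profile hσ hD.δ_pos he he0)
  have h2 := tendsto_profileEnergy hσ hD.δ_pos he he0
  have := (((h1.const_mul 4).const_mul (k : ℝ)).add ((h2.const_mul 2).const_mul a)).const_mul (2 * l)
  convert this using 2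
  rw [c0_eq hσ]; ring

/-- Pointwise convergence of the angle of the recovery sequence. -/
theorem tendsto_profile_truncDist (hσ : 0 < σ) {e : ℕ → ℝ} (he : ∀ j, 0 < e j)
    (he0 : Tendsto e atTop (𝓝 0)) (hv : ∀ x, v x = 1 ∨ v x = -1) {x : ℝ} (hx : 0 < v x * D x) :
    Tendsto (fun j => profile σ (e j) (D x)) atTop (𝓝 (v x * angle σ)) := by
  rcases hv x with h | h
  · rw [h, one_mul] at hx ⊢
    exact tendsto_profile hσ hx he he0
  · rw [h, neg_one_mul] at hx ⊢
    have := (tendsto_profile hσ hx he he0).neg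
    simpa only [profile_neg, neg_neg] using this

theorem tendsto_eLpNorm_recDir (hσ : 0 < σ) {e : ℕ → ℝ} (he : ∀ j, 0 < e j)
    (he0 : Tendsto e atTop (𝓝 0)) (hm : Measurable v) (hv : ∀ x, v x = 1 ∨ v x = -1)
    (hD : IsTruncDist l v k δ a D) {n : ℝ × ℝ → E3}
    (hn : ∀ᵐ p ∂(torus l), n p = circlePt (v p.1 * angle σ)) :
    Tendsto (fun j => eLpNorm (fun p => recDir σ (e j) D p.1 - n p) 1 (torus l)) atTop (𝓝 0) := by
  have hc := contDiff_circlePt.continuous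
  have hcg : ∀ j, eLpNorm (fun p => recDir σ (e j) D p.1 - n p) 1 (torus l)
      = ∫⁻ p, ‖recDir σ (e j) D p.1 - circlePt (v p.1 * angle σ)‖ₑ ∂(torus l) := fun j => by
    rw [← eLpNorm_one_eq_lintegral_enorm]
    exact eLpNorm_congr_ae (hn.mono fun p hp => by simp only [hp])
  simp only [hcg]
  have h0 : (0 : ℝ≥0∞) = ∫⁻ p, 0 ∂(torus l) := by simp
  rw [h0]
  refine tendsto_lintegral_of_dominated_convergence (fun _ => 2) (fun j => ?_) (fun j => ?_) ?_ ?_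
  · have m1 : Measurable fun p : ℝ × ℝ => recDir σ (e j) D p.1 :=
      (hc.comp ((continuous_profile hσ (e j)).comp hD.lipschitz.continuous)).measurable.comp
        measurable_fst
    have m2 : Measurable fun p : ℝ × ℝ => circlePt (v p.1 * angle σ) :=
      hc.measurable.comp ((hm.comp measurable_fst).mul_const _)
    exact (m1.sub m2).enorm
  · refine Eventually.of_forall fun p => ?_
    refine (enorm_sub_le).trans ?_
    have : ∀ θ, ‖circlePt θ‖ₑ = 1 := fun θ => by
      rw [← ofReal_norm, norm_circlePt, ENNReal.ofReal_one]
    rw [recDir, this, this]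
    norm_num
  · rw [lintegral_const]
    exact ENNReal.mul_ne_top (by simp) (measure_ne_top _ _)
  · filter_upwards [ae_torus_fst (l := l) (ae_restrict_of_ae hD.sign)] with p hp
    have h1 := (hc.tendsto _).comp (tendsto_profile_truncDist hσ he he0 hv hp)
    have h2 := (h1.sub_const (circlePt (v p.1 * angle σ))).enorm
    simpa [recDir, Function.comp_def] using h2

/-- Both displacements are primitives with the same constant `C`, so their distance is bounded
uniformly by the `L¹` distance `d j` of the first components of the directors. -/
theorem tendsto_eLpNorm_recDisp (hl : 0 < l) (hσ : 0 < σ) {e : ℕ → ℝ} (he : ∀ j, 0 < e j)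
    (he0 : Tendsto e atTop (𝓝 0)) (hm : Measurable v) (hv : ∀ x, v x = 1 ∨ v x = -1)
    (hD : IsTruncDist l v k δ a D) {g : ℝ × ℝ → ℝ} {C : ℝ}
    (hg : ∀ᵐ p ∂(torus l), g p = C - ∫ t in (0 : ℝ)..p.1, nbar σ * v t) :
    Tendsto (fun j => eLpNorm (fun p => recDisp σ (e j) D C p.1 - g p) 2 (torus l)) atTop
      (𝓝 0) := by
  have hvi : ∀ a b, IntervalIntegrable (fun t => nbar σ * v t) volume a b := fun a b =>
    (intervalIntegrable_of_two_valued hm hv a b).const_mul _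
  have hni : ∀ j a b, IntervalIntegrable (fun t => recDir σ (e j) D t 0) volume a b :=
    fun j a b => (continuous_recDir_zero hσ hD).intervalIntegrable _ _
  have hdi : ∀ j a b, IntervalIntegrable (fun t => |recDir σ (e j) D t 0 - nbar σ * v t|) volume
      a b := fun j a b => ((hni j a b).sub (hvi a b)).norm
  have hle : -l ≤ l := by linarith
  set d : ℕ → ℝ := fun j => ∫ t in -l..l, |recDir σ (e j) D t 0 - nbar σ * v t| with hd
  have hd0 : Tendsto d atTop (𝓝 0) := by
    have h0 : (0 : ℝ) = ∫ t in -l..l, (0 : ℝ) := by simp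
    rw [h0]
    refine intervalIntegral.tendsto_integral_filter_of_dominated_convergence
      (fun _ => 1 + |nbar σ|) (Eventually.of_forall fun j => ?_) (Eventually.of_forall fun j => ?_)
      intervalIntegrable_const ?_
    · exact (((continuous_recDir_zero hσ hD).measurable).sub
        (hm.const_mul _)).norm.aestronglyMeasurable
    · refine Eventually.of_forall fun t _ => ?_
      rw [Real.norm_eq_abs, abs_abs]
      refine (abs_sub _ _).trans (add_le_add (by rw [recDir_zero]; exact Real.abs_sin_le_one _) ?_)
      rcases hv t with h | h <;> simp [h]
    · filter_upwards [hD.sign] with t ht _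
      have h1 := (Real.continuous_sin.tendsto _).comp (tendsto_profile_truncDist hσ he he0 hv ht)
      have h2 : Real.sin (v t * angle σ) = nbar σ * v t := by
        rcases hv t with h | h <;> simp [h, sin_angle]
      rw [h2] at h1
      have h3 := (h1.sub_const (nbar σ * v t)).abs
      simpa [recDir_zero, Function.comp_def] using h3
  have hb : ∀ j, eLpNorm (fun p => recDisp σ (e j) D C p.1 - g p) 2 (torus l)
      ≤ torus l univ ^ (2 : ℝ≥0∞).toReal⁻¹ * ENNReal.ofReal (d j) := fun j => by
    refine eLpNorm_le_of_ae_bound ?_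
    have hmem : ∀ᵐ p ∂(torus l), p.1 ∈ Ico (-l) l := ae_torus_fst (ae_restrict_mem measurableSet_Ico)
    filter_upwards [hg, hmem] with p hp hpm
    rw [hp, recDisp, show (C - ∫ t in (0 : ℝ)..p.1, recDir σ (e j) D t 0)
        - (C - ∫ t in (0 : ℝ)..p.1, nbar σ * v t)
        = (∫ t in (0 : ℝ)..p.1, nbar σ * v t) - ∫ t in (0 : ℝ)..p.1, recDir σ (e j) D t 0 by ring,
      ← intervalIntegral.integral_sub (hvi _ _) (hni j _ _)]
    refine intervalIntegral.norm_integral_le_integral_norm_uIoc.trans ?_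
    rw [hd]
    simp only
    rw [intervalIntegral.integral_of_le hle]
    have hsub : uIoc 0 p.1 ⊆ Ioc (-l) l := by
      intro t ht
      rw [mem_uIoc] at ht
      rcases ht with ht | ht
      · exact ⟨by linarith [ht.1], by linarith [ht.2, hpm.2]⟩
      · exact ⟨by linarith [ht.1, hpm.1], by linarith [ht.2]⟩
    have e1 : ∀ t, ‖nbar σ * v t - recDir σ (e j) D t 0‖ = |recDir σ (e j) D t 0 - nbar σ * v t| :=
      fun t => by rw [Real.norm_eq_abs, abs_sub_comm]
    simp only [e1]
    exact setIntegral_mono_set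
      ((intervalIntegrable_iff_integrableOn_Ioc_of_le hle).1 (hdi j _ _))
      (Eventually.of_forall fun t => abs_nonneg _) hsub.eventuallyLE
  have hlim : Tendsto (fun j => torus l univ ^ (2 : ℝ≥0∞).toReal⁻¹ * ENNReal.ofReal (d j)) atTop
      (𝓝 0) := by
    have h1 := (ENNReal.continuous_ofReal.tendsto 0).comp hd0
    rw [ENNReal.ofReal_zero] at h1
    have h2 := ENNReal.Tendsto.const_mul (a := torus l univ ^ (2 : ℝ≥0∞).toReal⁻¹) h1
      (Or.inr (ENNReal.rpow_ne_top_of_nonneg (by simp) (measure_ne_top _ _)))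
    rwa [mul_zero] at h2
  exact tendsto_of_tendsto_of_tendsto_of_le_of_le tendsto_const_nhds hlim (fun _ => zero_le) hb

end Recovery

/-! ### Limit configurations -/

/-- The sign of a measurable version of `n₁` on one period, extended periodically. Being measurable,
periodic and `±1` everywhere, `v` spares all later arguments the exceptional sets. -/
theorem exists_two_valued_repr {l σ : ℝ} (hl : 0 < l) (hσ : 0 < σ) {n : ℝ × ℝ → E3}
    (hi : Integrable (fun p => n p 0) (torus l))
    (hw : ∀ᵐ p ∂(torus l), n p = nPlus σ ∨ n p = nMinus σ)
    (hm : ∃ m : ℝ → E3, ∀ᵐ p ∂(torus l), n p = m p.1) :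
    ∃ v : ℝ → ℝ, Measurable v ∧ (∀ x, v x = 1 ∨ v x = -1) ∧ v.Periodic (2 * l) ∧
      ∀ᵐ p ∂(torus l), n p = circlePt (v p.1 * angle σ) := by
  obtain ⟨m, hm⟩ := hm
  have hT : (0 : ℝ) < 2 * l := by linarith
  have h1 : AEStronglyMeasurable (fun p : ℝ × ℝ => m p.1 0) (torus l) :=
    hi.1.congr (hm.mono fun p hp => by simp only [hp])
  have h2 := aestronglyMeasurable_of_fst (f := fun x => m x 0) hl h1
  set w := h2.mk _ with hwdef
  have hwm : Measurable w := h2.stronglyMeasurable_mk.measurable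
  have hmod : Measurable (toIcoMod hT (-l)) := by
    have : toIcoMod hT (-l) = fun x => -l + Int.fract ((x - -l) / (2 * l)) * (2 * l) := by
      ext x; exact toIcoMod_eq_add_fract_mul hT (-l) x
    rw [this]
    exact measurable_const.add ((measurable_fract.comp
      ((measurable_id.sub_const _).div_const _)).mul_const _)
  refine ⟨fun x => if 0 < w (toIcoMod hT (-l) x) then 1 else -1, ?_, fun x => ?_, fun x => ?_, ?_⟩
  · exact Measurable.ite (measurableSet_lt measurable_const (hwm.comp hmod)) measurable_const
      measurable_const
  · dsimp only
    split_ifs <;> simp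
  · simp only [toIcoMod_add_right]
  · have hwe := ae_torus_fst (l := l) h2.ae_eq_mk
    have hmem : ∀ᵐ p ∂(torus l), p.1 ∈ Ico (-l) l := ae_torus_fst (ae_restrict_mem measurableSet_Ico)
    filter_upwards [hwe, hmem, hm, hw] with p e1 e2 e3 e4
    have e5 : toIcoMod hT (-l) p.1 = p.1 :=
      (toIcoMod_eq_self hT).2 ⟨e2.1, by linarith [e2.2]⟩
    rw [e5, hwdef, ← e1, ← e3]
    have hn := nbar_pos hσ
    rcases e4 with h | h
    · rw [h, if_pos (by simpa [nPlus] using hn), one_mul, circlePt_angle hσ]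
    · rw [h, if_neg (by simpa [nMinus] using hn.le), neg_one_mul, circlePt_neg_angle hσ]

/-- The primitive of `-M v` is periodic because `v` has mean zero. It has the same weak derivative
as `g`, and the difference, a function of `x` alone, is constant. -/
theorem exists_primitive_repr {l M : ℝ} (hl : 0 < l) {v : ℝ → ℝ} (hm : Measurable v)
    (hv : ∀ x, v x = 1 ∨ v x = -1) (hp : v.Periodic (2 * l)) (h0 : ∫ x in -l..l, v x = 0)
    {g : ℝ × ℝ → ℝ} (hg : HasWeakDeriv l ex g (fun p => -(M * v p.1)))
    (hgx : ∃ h : ℝ → ℝ, ∀ᵐ p ∂(torus l), g p = h p.1) :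
    ∃ C, ∀ᵐ p ∂(torus l), g p = C - ∫ t in (0 : ℝ)..p.1, M * v t := by
  obtain ⟨h, hh⟩ := hgx
  have hi : ∀ a b, IntervalIntegrable (fun t => M * v t) volume a b := fun a b =>
    (intervalIntegrable_of_two_valued hm hv a b).const_mul _
  set u : ℝ → ℝ := fun x => 0 - ∫ t in (0 : ℝ)..x, M * v t with hu
  have hul : LipschitzWith (Real.toNNReal |M|) u := primitive_lipschitz hi (fun x => by
    rw [Real.coe_toNNReal _ (abs_nonneg _)]
    rcases hv x with h | h <;> simp [h]) 0
  have hup : u.Periodic (2 * l) := primitive_periodic hi (fun x => by simp only [hp x])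
    (by rw [intervalIntegral.integral_const_mul, h0, mul_zero]) 0
  have hud : (fun p : ℝ × ℝ => deriv u p.1) =ᵐ[torus l] fun p => -(M * v p.1) := by
    refine ae_torus_fst (P := fun x => deriv u x = -(M * v x)) (ae_restrict_of_ae ?_)
    have hloc : LocallyIntegrable (fun t => M * v t) volume :=
      (locallyIntegrable_of_two_valued hm hv).smul M
    filter_upwards [_root_.LocallyIntegrable.ae_hasDerivAt_integral hloc] with x hx
    exact ((hx 0).const_sub 0).deriv
  have hwu := (hasWeakDeriv_ex_of_lipschitz hl hul hup).congr hud
  have hdiff : (fun p => g p - u p.1) =ᵐ[torus l] fun p => h p.1 - u p.1 :=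
    hh.mono fun p hp => by simp only [hp]
  have hint : Integrable (fun p : ℝ × ℝ => h p.1 - u p.1) (torus l) :=
    (hg.1.sub hwu.1).congr hdiff
  have hzero : HasWeakDeriv l ex (fun p => h p.1 - u p.1) 0 := by
    refine ⟨hint, integrable_zero _ _ _, fun φ hφ => ?_⟩
    have e1 : ∫ p, (h p.1 - u p.1) * fderiv ℝ φ p ex ∂(torus l)
        = ∫ p, g p * fderiv ℝ φ p ex - u p.1 * fderiv ℝ φ p ex ∂(torus l) :=
      integral_congr_ae (hdiff.mono fun p hp => by
        simp only at hp
        simp only [← hp]; ring)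
    rw [e1, integral_sub (integrable_mul_continuous hg.1 (hφ.continuous_fderiv ex))
      (integrable_mul_continuous hwu.1 (hφ.continuous_fderiv ex)), hg.2.2 φ hφ, hwu.2.2 φ hφ]
    simp
  have hint1 : IntegrableOn (fun x => h x - u x) (Ico (-l) l) := by
    rw [torus_eq_prod] at hint
    refine Integrable.of_comp_fst (ν := volume.restrict (Ico (-l) l)) hint fun h0 => ?_
    have := congrArg (fun μ => μ univ) h0
    simp at this
    linarith
  obtain ⟨C, hC⟩ := ae_const_of_hasWeakDeriv_zero hl hint1 hzero
  refine ⟨C, ?_⟩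
  filter_upwards [hh, ae_torus_fst hC] with p e1 e2
  rw [e1]
  simp only [hu] at e2
  linarith

end Smectic

/-! ### Existence of recovery sequences -/

theorem lemma2p3 (l σ : ℝ) (hl : 0 < l) (hσ : 0 < σ)
    (ε : ℕ → ℝ) (hε : ∀ j, 0 < ε j) (hε0 : Tendsto ε atTop (𝓝 0))
    (n : ℝ × ℝ → Smectic.E3) (g : ℝ × ℝ → ℝ) (hng : (n, g) ∈ Smectic.setA l σ) :
    ∃ (N : ℕ → ℝ × ℝ → Smectic.E3) (h : ℕ → ℝ × ℝ → ℝ),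
      (∀ j, (N j, h j) ∈ Smectic.setY l) ∧
      Tendsto (fun j => eLpNorm (fun p => N j p - n p) 1 (Smectic.torus l)) atTop (𝓝 0) ∧
      Tendsto (fun j => eLpNorm (fun p => h j p - g p) 2 (Smectic.torus l)) atTop (𝓝 0) ∧
      limsup (fun j => Smectic.energyG l σ (ε j) (N j) (h j)) atTop
        = Smectic.energyG0 l σ n g ∧
      (∀ j, ∃ s : ℝ → ℝ, (∀ x, s x ∈ Icc (0 : ℝ) 1) ∧
        ∀ᵐ p ∂(Smectic.torus l), N j p = Smectic.greatArc σ (s p.1)) ∧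
      (∀ j, ∫ p, N j p 0 ∂(Smectic.torus l) = 0) := by
  open Smectic in
  have hng' := hng
  obtain ⟨hBV, hw, hgW, -, -, hgx, hnx, hgn, -, hmean⟩ := hng'
  have hn := nbar_pos hσ
  obtain ⟨v, hm, hv, hp, hnv⟩ := exists_two_valued_repr hl hσ (hBV 0).1 hw hnx
  have hn0 : ∀ᵐ p ∂(torus l), n p 0 = nbar σ * v p.1 := by
    filter_upwards [hnv] with p e
    rw [e]
    rcases hv p.1 with h | h <;> simp [h, circlePt, sin_angle]
  have h0 : ∫ x in -l..l, v x = 0 := by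
    have h1 : ∫ p, n p 0 ∂(torus l) = 0 := hmean
    rw [integral_congr_ae hn0, integral_torus_fst hl (fun x => nbar σ * v x),
      intervalIntegral.integral_const_mul] at h1
    have : 2 * l * nbar σ ≠ 0 := by positivity
    rw [← mul_assoc] at h1
    exact (mul_eq_zero.1 h1).resolve_left this
  have hu : (fun p => n p 0) =ᵐ[torus l] fun p => 0 + nbar σ * v p.1 :=
    hn0.mono fun p e => by simp only [e, zero_add]
  -- The divisor accounts for the width `2 * l` of the torus in `y` and for the factor `nbar σ`
  -- between `v` and `n₁`.
  obtain ⟨k, δ, a, D, hD, htest⟩ := exists_isTruncDist hl hm hv hp h0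
    (C := (totalVariation l fun p => n p 0).toReal / (2 * l * nbar σ)) fun φ h1 h2 h3 => by
      have := le_totalVariation hl hm hv hu h1 h2 h3
      rw [ENNReal.ofReal_le_iff_le_toReal (hBV 0).2.ne] at this
      rw [le_div_iff₀ (by positivity)]
      linarith
  have hgd : HasWeakDeriv l ex g (fun p => -(nbar σ * v p.1)) := by
    obtain ⟨g', hg', -⟩ := hgW.2.1
    refine (hasWeakDeriv_weakDeriv ⟨g', hg'⟩).congr ?_
    filter_upwards [hgn, hn0] with p e1 e2
    simp only [e2] at e1
    linarith
  obtain ⟨C, hC⟩ := exists_primitive_repr hl hm hv hp h0 hgd hgx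
  have hper := hD.perimeter_eq hl hm hv htest (E := {p | n p = nMinus σ}) (by
    filter_upwards [hnv] with p e
    rw [show n p = circlePt (v p.1 * angle σ) from e]
    rcases hv p.1 with h | h
    · rw [h, one_mul, circlePt_angle hσ]
      constructor
      · intro he
        have := congrArg (fun z : E3 => z 0) he
        simp only [nPlus, nMinus, PiLp.toLp_apply, Matrix.cons_val_zero] at this
        linarith
      · intro he; norm_num at he
    · rw [h, neg_one_mul, circlePt_neg_angle hσ]
      simp)
  refine ⟨fun j p => recDir σ (ε j) D p.1, fun j p => recDisp σ (ε j) D C p.1,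
    fun j => recovery_mem_setY hl hσ (hε j) hD C, tendsto_eLpNorm_recDir hσ hε hε0 hm hv hD hnv,
    tendsto_eLpNorm_recDisp hl hσ hε hε0 hm hv hD hC, ?_, fun j => ?_, fun j => ?_⟩
  · rw [(tendsto_energyG_recovery hl hσ hε hε0 hD C).limsup_eq, energyG0, if_pos hng, hper]
  · have hα := angle_pos hσ
    -- The parameter at which the great arc has angle `profile σ (ε j) (D x)`.
    refine ⟨fun x => (profile σ (ε j) (D x) + angle σ) / (2 * angle σ), fun x => ?_,
      Eventually.of_forall fun p => ?_⟩
    · obtain ⟨h1, h2⟩ := abs_le.1 (abs_profile_le hσ (ε j) (D x))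
      exact ⟨div_nonneg (by linarith) (by linarith), (div_le_one (by linarith)).2 (by linarith)⟩
    · rw [greatArc_eq]
      simp only [recDir]
      congr 1
      field_simp
      ring
  · rw [integral_torus_fst hl (fun x => recDir σ (ε j) D x 0), integral_recDir_zero hσ hD, mul_zero]
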